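/- Let $\mathcal S_1$ (states) and $\mathcal S_2$ (signals) be non-empty finite sets, $M_1=|\mathcal S_1|$. Consider the repeated signaling game with Roth--Erev reinforcement: fix initial payoffs $V(0,i,j)>0$ for $(i,j)\in\mathcal S_1\times\mathcal S_2$ (for instance all equal to $1$). In round $n$, given the past, a state $i$ is drawn uniformly from $\mathcal S_1$; Sender sends signal $j$ with probability $V(n,i,j)/\sum_{l\in\mathcal S_2}V(n,i,l)$; Receiver, seeing only $j$, chooses an act $k\in\mathcal S_1$ with probability $V(n,k,j)/\sum_{l\in\mathcal S_1}V(n,l,j)$. If $k=i$ then $V(n+1,i,j)=V(n,i,j)+1$, and all other payoffs are unchanged; if $k\neq i$ no payoff changes. Let $T_n=\sum_{i,j}V(n,i,j)$, let $x_n=\big(V(n,i,j)/T_n\big)_{i,j}$ be the occupation measure, and let $V(\infty,i,j)=\lim_n V(n,i,j)\in(0,\infty]$. Let $\Delta=\{x\in[0,\infty)^{\mathcal S_1\times\mathcal S_2}:\sum_{i,j}x_{ij}=1\}$. For $x\in\Delta$ put $x_i=\sum_{j\in\mathcal S_2}x_{ij}$ for $i\in\mathcal S_1$ and $x_j=\sum_{i\in\mathcal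 S_1}x_{ij}$ for $j\in\mathcal S_2$, $y_{ij}(x)=x_{ij}/(x_ix_j)$, $H(x)=\sum_{i,j:\,x_{ij}>0}x_{ij}^2/(x_ix_j)$, and $F(x)_{ij}=x_{ij}(y_{ij}(x)-H(x))$ (equal to $0$ if $x_{ij}=0$). Let $\mathcal G_x$ be the bipartite graph on $\mathcal S_1\cup\mathcal S_2$ in which $i\in\mathcal S_1$ and $j\in\mathcal S_2$ are joined iff $x_{ij}>0$, the edge $\{i,j\}$ carrying the weight $y_{ij}(x)$. Let $\Gamma_s$ be the set of $q\in\Delta$ with $F(q)=0$, $q_i>0$ for every $i\in\mathcal S_1\cup\mathcal S_2$, and such that all eigenvalues of the Jacobian matrix of $F$ at $q$ (with respect to the coordinates $x_{ij}$) have nonpositive real part (linearly stable equilibria). 1. Let $\mathcal G$ be a graph on $\mathcal S_1\cup\mathcal S_2$, all of whose edges join a state to a signal, such that every vertex has an edge and every connected component contains exactly one state or exactly one signal. Then with positive probability both of the following hold: (a) $x_n$ converges to some $x\in\Delta$ with $\mathcal G_x=\mathcal G$ (as unweighted graphs); (b) for all $i\in\mathcal S_1$, $j\in\mathcal S_2$,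 $V(\infty,i,j)=\infty$ if and only if $\{i,j\}$ is an edge of $\mathcal G$. 2. Let $q\in\Gamma_s$ and let $\mathcal N(q)$ be a neighbourhood of $q$ in $\Delta$. Then with positive probability both of the following hold: (a) $x_n$ converges to some $x\in\mathcal N(q)$ with $\mathcal G_x=\mathcal G_q$ (as weighted graphs); (b) for all $i\in\mathcal S_1$, $j\in\mathcal S_2$, $V(\infty,i,j)=\infty$ if and only if $\{i,j\}$ is an edge of $\mathcal G_q$. -/

import Mathlib

open MeasureTheory Filter Topology

noncomputable section

namespace SignalingGame

variable {S₁ S₂ Ω : Type*} [Fintype S₁] [Fintype S₂]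

/-! ### Vectors indexed by strategy pairs (state, signal) -/

/-- The marginal `x_i = ∑_j x_{ij}` of a state `i`. -/
def stateMass (x : S₁ × S₂ → ℝ) (i : S₁) : ℝ := ∑ j, x (i, j)

/-- The marginal `x_j = ∑_i x_{ij}` of a signal `j`. -/
def signalMass (x : S₁ × S₂ → ℝ) (j : S₂) : ℝ := ∑ i, x (i, j)

/-- The simplex `Δ`. -/
def simplex (S₁ S₂ : Type*) [Fintype S₁] [Fintype S₂] : Set (S₁ × S₂ → ℝ) :=
  {x | (∀ p, 0 ≤ x p) ∧ ∑ p, x p = 1}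

/-- The boundary `∂Δ`: some state or some signal has mass zero. -/
def simplexBoundary (S₁ S₂ : Type*) [Fintype S₁] [Fintype S₂] : Set (S₁ × S₂ → ℝ) :=
  {x | x ∈ simplex S₁ S₂ ∧ ((∃ i, stateMass x i = 0) ∨ ∃ j, signalMass x j = 0)}

/-- The efficiency `y_{ij} = x_{ij} / (x_i x_j)` of a strategy pair. -/
def efficiency (x : S₁ × S₂ → ℝ) (p : S₁ × S₂) : ℝ :=
  x p / (stateMass x p.1 * signalMass x p.2)

/-- The communication potential `H(x) = ∑ x_{ij}² / (x_i x_j)`; on `Δ` the pairs with `x_{ij} = 0`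
contribute `0`. -/
def potential (x : S₁ × S₂ → ℝ) : ℝ :=
  ∑ p, x p ^ 2 / (stateMass x p.1 * signalMass x p.2)

/-- The vector field `F(x)_{ij} = x_{ij} (y_{ij} - H(x))` of the mean-field ODE; it is `0` in every
coordinate with `x_{ij} = 0`. -/
def meanField (x : S₁ × S₂ → ℝ) : S₁ × S₂ → ℝ :=
  fun p => x p * (efficiency x p - potential x)

/-- The set `Γ` of equilibria. -/
def equilibria (S₁ S₂ : Type*) [Fintype S₁] [Fintype S₂] : Set (S₁ × S₂ → ℝ) :=
  {x | x ∈ simplex S₁ S₂ ∧ meanField x = 0}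

/-- The Jacobian matrix of `F` at `x`, with respect to all coordinates `x_{ij}`. -/
def jacobian [DecidableEq S₁] [DecidableEq S₂] (x : S₁ × S₂ → ℝ) :
    Matrix (S₁ × S₂) (S₁ × S₂) ℝ :=
  LinearMap.toMatrix' (fderiv ℝ (meanField : (S₁ × S₂ → ℝ) → S₁ × S₂ → ℝ) x).toLinearMap

/-- All complex eigenvalues of the Jacobian matrix have nonpositive real part. -/
def LinearlyStable [DecidableEq S₁] [DecidableEq S₂] (x : S₁ × S₂ → ℝ) : Prop :=
  ∀ z ∈ spectrum ℂ ((jacobian x).map (algebraMap ℝ ℂ)), z.re ≤ 0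

/-- The set `Γ_s` of linearly stable equilibria in `Δ \ ∂Δ`. -/
def stableEquilibria (S₁ S₂ : Type*) [Fintype S₁] [Fintype S₂] [DecidableEq S₁] [DecidableEq S₂] :
    Set (S₁ × S₂ → ℝ) :=
  {x | x ∈ equilibria S₁ S₂ ∧ x ∉ simplexBoundary S₁ S₂ ∧ LinearlyStable x}

/-! ### Graphs on states and signals -/

/-- The bipartite graph underlying `𝒢_x`: state `i` and signal `j` are adjacent iff `x_{ij} > 0`. -/
def supportGraph (x : S₁ × S₂ → ℝ) : SimpleGraph (S₁ ⊕ S₂) :=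
  SimpleGraph.fromRel fun u v => ∃ i j, u = Sum.inl i ∧ v = Sum.inr j ∧ 0 < x (i, j)

/-- Every connected component has a single state or a single signal, and every vertex has an
edge. -/
structure PropertyP (G : SimpleGraph (S₁ ⊕ S₂)) : Prop where
  component : ∀ C : G.ConnectedComponent,
    (∃! i : S₁, Sum.inl i ∈ C.supp) ∨ ∃! j : S₂, Sum.inr j ∈ C.supp
  edge : ∀ v, ∃ w, G.Adj v w

/-! ### The reinforcement learning process -/

/-- The accumulated payoffs `V(n, i, j)`. In round `n` nature draws the state `S n`, Sender sends the
signal `Y n` and Receiver chooses the act `Z n`; acts are identified with states. The pair `(i, j)`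
gains one unit when state `i` was drawn, signal `j` was sent and act `i` was chosen. -/
def payoff [DecidableEq S₁] [DecidableEq S₂] (V₀ : S₁ × S₂ → ℝ)
    (S : ℕ → Ω → S₁) (Y : ℕ → Ω → S₂) (Z : ℕ → Ω → S₁) : ℕ → Ω → S₁ × S₂ → ℝ
  | 0, _, p => V₀ p
  | n + 1, ω, p => payoff V₀ S Y Z n ω p +
      if S n ω = p.1 ∧ Y n ω = p.2 ∧ Z n ω = p.1 then 1 else 0

/-- The occupation measure `x_n = V_n / T_n`, where `T_n = ∑ V(n, i, j)`. -/
def occupation [DecidableEq S₁] [DecidableEq S₂] (V₀ : S₁ × S₂ → ℝ)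
    (S : ℕ → Ω → S₁) (Y : ℕ → Ω → S₂) (Z : ℕ → Ω → S₁) (n : ℕ) (ω : Ω) : S₁ × S₂ → ℝ :=
  fun p => payoff V₀ S Y Z n ω p / ∑ r, payoff V₀ S Y Z n ω r

/-- The probability, given the payoffs `V`, that nature draws state `i` (uniformly), Sender then
sends signal `j` (proportionally to `V(i, ·)`), and Receiver then chooses act `k`
(proportionally to `V(·, j)`). -/
def roundProb (V : S₁ × S₂ → ℝ) (i : S₁) (j : S₂) (k : S₁) : ℝ :=
  1 / (Fintype.card S₁ : ℝ) * (V (i, j) / stateMass V i) * (V (k, j) / signalMass V j)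

/-- `(S, Y, Z)` are the states, signals and acts of the repeated signaling game played with the
Roth-Erev reinforcement rule from initial payoffs `V₀`: given the past `ℱ n` before round `n`, the
round `(S n, Y n, Z n)` has the distribution `roundProb`. -/
structure IsRothErevGame [DecidableEq S₁] [DecidableEq S₂] {mΩ : MeasurableSpace Ω}
    (μ : Measure Ω) (ℱ : Filtration ℕ mΩ) (V₀ : S₁ × S₂ → ℝ)
    (S : ℕ → Ω → S₁) (Y : ℕ → Ω → S₂) (Z : ℕ → Ω → S₁) : Prop where
  measurable_state : ∀ n i, MeasurableSet[ℱ (n + 1)] {ω | S n ω = i}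
  measurable_signal : ∀ n j, MeasurableSet[ℱ (n + 1)] {ω | Y n ω = j}
  measurable_act : ∀ n k, MeasurableSet[ℱ (n + 1)] {ω | Z n ω = k}
  round_law : ∀ n i j k,
    μ[Set.indicator {ω | S n ω = i ∧ Y n ω = j ∧ Z n ω = k} (fun _ => (1 : ℝ)) | ℱ n]
      =ᵐ[μ] fun ω => roundProb (payoff V₀ S Y Z n ω) i j k

end SignalingGame

end

open SignalingGame

noncomputable section

set_option linter.unusedSectionVars false

namespace SignalingGame

variable {S₁ S₂ Ω : Type*} [Fintype S₁] [Fintype S₂]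

/-! ### The payoffs as a Markov chain -/

/-! Both claims concern star forests: sets `E` of pairs that cover all vertices and whose
components, as a bipartite graph, are stars. For Part 1, `PropertyP.isStarForest` gives a star
forest, and `IsStarForest.exists_equilibrium` puts an equilibrium on it. For Part 2,
`LinearlyStable.no_path` excludes paths of three edges in the support of a stable equilibrium: on
the support the Jacobian is conjugate to a symmetric matrix, and such a path supplies a test vector
of the wrong sign. Both parts then follow from `IsRothErevGame.measure_tendsto_pos`.

Suppose that the payoffs outside `E` are bounded and that the stars have large mass. On an edge, one
end has mass about `v e` and the other about the star mass `c`, so with `M` states the edge is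
reinforced with probability about `v e / (M c)`. Hence every star gains at rate about `1 / M`
whatever its mass, the shares within a star form a Pólya urn up to an error of order `1 / c ^ 2`,
and a pair outside `E` joining stars of masses `c` and `c'` is reinforced with probability of order
`1 / (c c')`. The function `1 / c` has drift at most `-1 / (4 M c ^ 2)`, so a large multiple of its
sum absorbs all these errors. This makes `forestLyapunov` a Lyapunov function
(`exists_isLyapunov_forestLyapunov`).

Truncated at `1`, a Lyapunov function is a bounded supermartingale. Started below `1/4`, it stays
below `1/2` forever with positive probability, and a good start is reached by prescribing finitely
many reinforcements. On the event of confinement the total drift is finite, so the star masses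
diverge. Adding a small multiple of a share, or of a squared imbalance of two stars, keeps the
Lyapunov property, so these quantities converge too. The imbalance contracts at a rate of order `1 /
n`, which is not summable, so its limit is `0` and the stars become asymptotically equal. The
occupation measure therefore converges to shares divided by the number of stars, and every edge has
this number as its limiting efficiency. -/

/-- The probability, given the payoffs `v`, that the pair `p` is reinforced. -/
def successProb (v : S₁ × S₂ → ℝ) (p : S₁ × S₂) : ℝ := roundProb v p.1 p.2 p.1

section Probability

variable [DecidableEq S₁] [DecidableEq S₂]

/-- The generator of the chain of payoffs: the expected increment of `φ` in one round. -/
def generator (φ : (S₁ × S₂ → ℝ) → ℝ) (v : S₁ × S₂ → ℝ) : ℝ :=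
  ∑ p, successProb v p * (φ (v + Pi.single p 1) - φ v)

lemma successProb_nonneg {v : S₁ × S₂ → ℝ} (hv : ∀ p, 0 ≤ v p) (p : S₁ × S₂) :
    0 ≤ successProb v p := by
  have h1 : 0 ≤ stateMass v p.1 := Finset.sum_nonneg fun _ _ => hv _
  have h2 : 0 ≤ signalMass v p.2 := Finset.sum_nonneg fun _ _ => hv _
  have := hv (p.1, p.2)
  unfold successProb roundProb
  positivity

/-- The event that the pair `p` is reinforced in round `n`. -/
def successEvent (S : ℕ → Ω → S₁) (Y : ℕ → Ω → S₂) (Z : ℕ → Ω → S₁) (n : ℕ) (p : S₁ × S₂) :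
    Set Ω := {ω | S n ω = p.1 ∧ Y n ω = p.2 ∧ Z n ω = p.1}

variable {V₀ : S₁ × S₂ → ℝ} {S : ℕ → Ω → S₁} {Y : ℕ → Ω → S₂} {Z : ℕ → Ω → S₁}

lemma payoff_succ_of_mem {n : ℕ} {p : S₁ × S₂} {ω : Ω} (h : ω ∈ successEvent S Y Z n p) :
    payoff V₀ S Y Z (n + 1) ω = payoff V₀ S Y Z n ω + Pi.single p 1 := by
  funext r
  obtain ⟨h1, h2, h3⟩ := h
  simp only [payoff, Pi.add_apply, Pi.single_apply, h1, h2, h3]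
  congr 1
  by_cases hr : r = p
  · simp [hr]
  · rw [if_neg, if_neg hr]
    rintro ⟨a, b, -⟩
    exact hr (Prod.ext a.symm b.symm)

lemma payoff_succ_of_forall_notMem {n : ℕ} {ω : Ω} (h : ∀ p, ω ∉ successEvent S Y Z n p) :
    payoff V₀ S Y Z (n + 1) ω = payoff V₀ S Y Z n ω := by
  funext r
  simp only [payoff]
  rw [if_neg (show ¬(S n ω = r.1 ∧ Y n ω = r.2 ∧ Z n ω = r.1) from h r), add_zero]

lemma eq_of_mem_successEvent {n : ℕ} {p r : S₁ × S₂} {ω : Ω} (h : ω ∈ successEvent S Y Z n p)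
    (h' : ω ∈ successEvent S Y Z n r) : p = r :=
  Prod.ext (h.1.symm.trans h'.1) (h.2.1.symm.trans h'.2.1)

/-- At most one success event occurs in a round, so at most one summand is nonzero. -/
lemma comp_payoff_succ (φ : (S₁ × S₂ → ℝ) → ℝ) (n : ℕ) (ω : Ω) :
    φ (payoff V₀ S Y Z (n + 1) ω) = φ (payoff V₀ S Y Z n ω) +
      ∑ p, (φ (payoff V₀ S Y Z n ω + Pi.single p 1) - φ (payoff V₀ S Y Z n ω)) *
        (successEvent S Y Z n p).indicator (fun _ => (1 : ℝ)) ω := by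
  by_cases h : ∃ p, ω ∈ successEvent S Y Z n p
  · obtain ⟨p, hp⟩ := h
    rw [payoff_succ_of_mem hp, Finset.sum_eq_single p]
    · simp [hp]
    · intro r _ hr
      rw [Set.indicator_of_notMem fun h' => hr (eq_of_mem_successEvent h' hp), mul_zero]
    · simp
  · push Not at h
    rw [payoff_succ_of_forall_notMem h, Finset.sum_eq_zero, add_zero]
    intro r _
    rw [Set.indicator_of_notMem (h r), mul_zero]

lemma le_payoff (n : ℕ) (ω : Ω) (p : S₁ × S₂) : V₀ p ≤ payoff V₀ S Y Z n ω p := by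
  induction n with
  | zero => exact le_rfl
  | succ n ih =>
    refine ih.trans ?_
    simp only [payoff]
    split_ifs <;> simp

lemma payoff_le (n : ℕ) (ω : Ω) (p : S₁ × S₂) : payoff V₀ S Y Z n ω p ≤ V₀ p + n := by
  induction n with
  | zero => simp [payoff]
  | succ n ih =>
    simp only [payoff]
    push_cast
    split_ifs <;> linarith

/-- Thanks to finiteness, any function of the payoffs, with no regularity assumed, is measurable and
bounded at a fixed time. -/
lemma finite_range_payoff (n : ℕ) : (Set.range (payoff V₀ S Y Z n)).Finite := by
  induction n with
  | zero =>
    refine (Set.finite_singleton V₀).subset ?_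
    rintro _ ⟨ω, rfl⟩
    rfl
  | succ n ih =>
    have hfin : (Set.range fun p : S₁ × S₂ => (Pi.single p 1 : S₁ × S₂ → ℝ)).Finite :=
      Set.finite_range _
    refine ((ih.image2 (· + ·) hfin).union ih).subset ?_
    rintro _ ⟨ω, rfl⟩
    by_cases h : ∃ p, ω ∈ successEvent S Y Z n p
    · obtain ⟨p, hp⟩ := h
      rw [payoff_succ_of_mem hp]
      exact Or.inl ⟨_, ⟨ω, rfl⟩, _, ⟨p, rfl⟩, rfl⟩
    · push Not at h
      rw [payoff_succ_of_forall_notMem h]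
      exact Or.inr ⟨ω, rfl⟩

variable {mΩ : MeasurableSpace Ω} {μ : Measure Ω} {ℱ : Filtration ℕ mΩ}

/-! ### Conditional expectation over one round -/

namespace IsRothErevGame

lemma measurableSet_successEvent (h : IsRothErevGame μ ℱ V₀ S Y Z) (n : ℕ) (p : S₁ × S₂) :
    MeasurableSet[ℱ (n + 1)] (successEvent S Y Z n p) :=
  (h.measurable_state n p.1).inter ((h.measurable_signal n p.2).inter (h.measurable_act n p.1))

lemma measurable_payoff (h : IsRothErevGame μ ℱ V₀ S Y Z) (n : ℕ) :
    Measurable[ℱ n] (payoff V₀ S Y Z n) := by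
  induction n with
  | zero => exact @measurable_const _ _ _ (ℱ 0) V₀
  | succ n ih =>
    refine @measurable_pi_lambda _ _ _ (ℱ (n + 1)) _ _ fun p => ?_
    have h1 : Measurable[ℱ (n + 1)] fun ω => payoff V₀ S Y Z n ω p :=
      (measurable_pi_apply p).comp (ih.mono (ℱ.mono n.le_succ) le_rfl)
    exact h1.add (Measurable.ite (h.measurableSet_successEvent n p) measurable_const
      measurable_const)

lemma measurable_comp_payoff (h : IsRothErevGame μ ℱ V₀ S Y Z)
    (φ : (S₁ × S₂ → ℝ) → ℝ) (n : ℕ) : Measurable[ℱ n] fun ω => φ (payoff V₀ S Y Z n ω) := by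
  intro s _
  have : (fun ω => φ (payoff V₀ S Y Z n ω)) ⁻¹' s =
      payoff V₀ S Y Z n ⁻¹' (φ ⁻¹' s ∩ Set.range (payoff V₀ S Y Z n)) := by
    ext ω; simp
  rw [this]
  exact h.measurable_payoff n ((finite_range_payoff n).inter_of_right _).measurableSet

lemma integrable_comp_payoff [IsFiniteMeasure μ] (h : IsRothErevGame μ ℱ V₀ S Y Z)
    (φ : (S₁ × S₂ → ℝ) → ℝ) (n : ℕ) : Integrable (fun ω => φ (payoff V₀ S Y Z n ω)) μ := by
  obtain ⟨c, hc⟩ := (((finite_range_payoff (V₀ := V₀) (S := S) (Y := Y) (Z := Z) n).image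
    fun v => ‖φ v‖).bddAbove)
  refine Integrable.of_bound
    ((h.measurable_comp_payoff φ n).mono (ℱ.le n) le_rfl).aestronglyMeasurable c ?_
  exact Eventually.of_forall fun ω => hc ⟨_, ⟨ω, rfl⟩, rfl⟩

/-- The only use of the law of a round: the increments in `comp_payoff_succ` are known given the
past, and each success indicator is replaced by its conditional probability. Everything afterwards
is deterministic calculus with `generator`. -/
lemma condExp_comp_payoff_succ [IsFiniteMeasure μ] (h : IsRothErevGame μ ℱ V₀ S Y Z)
    (φ : (S₁ × S₂ → ℝ) → ℝ) (n : ℕ) :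
    μ[fun ω => φ (payoff V₀ S Y Z (n + 1) ω) | ℱ n] =ᵐ[μ] fun ω =>
      φ (payoff V₀ S Y Z n ω) + generator φ (payoff V₀ S Y Z n ω) := by
  set ψ : S₁ × S₂ → Ω → ℝ := fun p ω =>
    φ (payoff V₀ S Y Z n ω + Pi.single p 1) - φ (payoff V₀ S Y Z n ω) with hψ
  set I : S₁ × S₂ → Ω → ℝ := fun p => (successEvent S Y Z n p).indicator fun _ => 1 with hI
  have hmeas : ∀ p, MeasurableSet (successEvent S Y Z n p) := fun p =>
    ℱ.le (n + 1) _ (h.measurableSet_successEvent n p)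
  have hψm : ∀ p, StronglyMeasurable[ℱ n] (ψ p) := fun p =>
    (h.measurable_comp_payoff (fun v => φ (v + Pi.single p 1) - φ v) n).stronglyMeasurable
  have hψi : ∀ p, Integrable (ψ p * I p) μ := fun p => by
    have : ψ p * I p = (successEvent S Y Z n p).indicator (ψ p) := by
      funext ω
      by_cases hω : ω ∈ successEvent S Y Z n p <;> simp [hI, hω]
    rw [this]
    exact (h.integrable_comp_payoff (fun v => φ (v + Pi.single p 1) - φ v) n).indicator (hmeas p)
  have heq : (fun ω => φ (payoff V₀ S Y Z (n + 1) ω)) =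
      (fun ω => φ (payoff V₀ S Y Z n ω)) + ∑ p, ψ p * I p := by
    funext ω
    rw [comp_payoff_succ φ n ω]
    simp [hψ, hI]
  have h1 : μ[fun ω => φ (payoff V₀ S Y Z n ω) | ℱ n] = fun ω => φ (payoff V₀ S Y Z n ω) :=
    condExp_of_stronglyMeasurable (ℱ.le n) (h.measurable_comp_payoff φ n).stronglyMeasurable
      (h.integrable_comp_payoff φ n)
  have h2 : ∀ p, μ[ψ p * I p | ℱ n] =ᵐ[μ]
      fun ω => ψ p ω * successProb (payoff V₀ S Y Z n ω) p := fun p => by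
    have := condExp_mul_of_stronglyMeasurable_left (hψm p) (hψi p)
      ((integrable_const (1 : ℝ)).indicator (hmeas p))
    filter_upwards [this, h.round_law n p.1 p.2 p.1] with ω hω hω'
    rw [hω]
    exact congrArg (ψ p ω * ·) hω'
  rw [heq]
  have h3 := condExp_add (h.integrable_comp_payoff φ n)
    (integrable_finsetSum' Finset.univ fun p _ => hψi p) (ℱ n)
  have h4 := condExp_finsetSum (s := Finset.univ) (fun p _ => hψi p) (ℱ n)
  filter_upwards [h3, h4, ae_all_iff.2 h2] with ω e3 e4 e2
  rw [e3, Pi.add_apply, h1, e4, Finset.sum_apply, generator]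
  congr 1
  refine Finset.sum_congr rfl fun p _ => ?_
  rw [e2, mul_comm]

lemma setIntegral_comp_payoff_succ [IsFiniteMeasure μ] (h : IsRothErevGame μ ℱ V₀ S Y Z)
    (φ : (S₁ × S₂ → ℝ) → ℝ) (n : ℕ) {A : Set Ω} (hA : MeasurableSet[ℱ n] A) :
    ∫ ω in A, φ (payoff V₀ S Y Z (n + 1) ω) ∂μ =
      ∫ ω in A, φ (payoff V₀ S Y Z n ω) + generator φ (payoff V₀ S Y Z n ω) ∂μ := by
  rw [← setIntegral_condExp (ℱ.le n) (h.integrable_comp_payoff φ (n + 1)) hA]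
  exact setIntegral_congr_ae (ℱ.le n _ hA)
    ((h.condExp_comp_payoff_succ φ n).mono fun ω hω _ => hω)

end IsRothErevGame

end Probability

/-! ### Lyapunov functions -/

section Lyapunov

variable [DecidableEq S₁] [DecidableEq S₂]

/-- `φ` is nonnegative, and below the level `1` its expected decrease in one round is at
least `D ≥ 0`. -/
structure IsLyapunov (V₀ : S₁ × S₂ → ℝ) (φ D : (S₁ × S₂ → ℝ) → ℝ) : Prop where
  nonneg : ∀ v, V₀ ≤ v → 0 ≤ φ v
  drift_nonneg : ∀ v, V₀ ≤ v → φ v < 1 → 0 ≤ D v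
  generator_le : ∀ v, V₀ ≤ v → φ v < 1 → generator φ v ≤ -D v

variable {V₀ : S₁ × S₂ → ℝ} {S : ℕ → Ω → S₁} {Y : ℕ → Ω → S₂} {Z : ℕ → Ω → S₁}
  {mΩ : MeasurableSpace Ω} {μ : Measure Ω} {ℱ : Filtration ℕ mΩ} {φ D : (S₁ × S₂ → ℝ) → ℝ}

/-- Truncation replaces stopping: below level `1` it can only lower the next value, and at or above
it the truncated function cannot increase. -/
lemma IsLyapunov.generator_min_le (hφ : IsLyapunov V₀ φ D) (hV₀ : ∀ p, 0 < V₀ p)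
    {v : S₁ × S₂ → ℝ} (hv : V₀ ≤ v) :
    generator (fun v => min (φ v) 1) v ≤ -(if φ v < 1 then D v else 0) := by
  have hp := successProb_nonneg fun p => (hV₀ p).le.trans (hv p)
  split_ifs with h
  · refine le_trans (Finset.sum_le_sum fun p _ => mul_le_mul_of_nonneg_left ?_ (hp p))
      (hφ.generator_le v hv h)
    beta_reduce
    rw [min_eq_left h.le]
    exact sub_le_sub_right (min_le_left _ _) _
  · rw [neg_zero]
    refine Finset.sum_nonpos fun p _ => mul_nonpos_of_nonneg_of_nonpos (hp p) ?_
    beta_reduce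
    rw [min_eq_right (not_lt.1 h)]
    linarith [min_le_right (φ (v + Pi.single p 1)) 1]

/-! ### Supermartingale arguments and reachability -/

namespace IsRothErevGame

variable [IsProbabilityMeasure μ]

lemma setIntegral_min_succ_le (h : IsRothErevGame μ ℱ V₀ S Y Z) (hV₀ : ∀ p, 0 < V₀ p)
    (hφ : IsLyapunov V₀ φ D) (n : ℕ) {A : Set Ω} (hA : MeasurableSet[ℱ n] A) :
    ∫ ω in A, min (φ (payoff V₀ S Y Z (n + 1) ω)) 1 ∂μ ≤
      ∫ ω in A, min (φ (payoff V₀ S Y Z n ω)) 1 ∂μ - ∫ ω in A,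
        (if φ (payoff V₀ S Y Z n ω) < 1 then D (payoff V₀ S Y Z n ω) else 0) ∂μ := by
  have h1 := h.integrable_comp_payoff (fun v => min (φ v) 1) n
  have h2 := h.integrable_comp_payoff (fun v => if φ v < 1 then D v else 0) n
  have h3 := h.integrable_comp_payoff (generator fun v => min (φ v) 1) n
  rw [h.setIntegral_comp_payoff_succ (fun v => min (φ v) 1) n hA,
    ← integral_sub h1.integrableOn h2.integrableOn]
  refine setIntegral_mono (h1.add h3).integrableOn (h1.sub h2).integrableOn fun ω => ?_
  have := hφ.generator_min_le hV₀ (le_payoff (S := S) (Y := Y) (Z := Z) n ω)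
  simp only
  linarith

/-- The truncated process is a supermartingale with values in `[0, 1]`. -/
lemma ae_tendsto_min (h : IsRothErevGame μ ℱ V₀ S Y Z) (hV₀ : ∀ p, 0 < V₀ p)
    (hφ : IsLyapunov V₀ φ D) :
    ∀ᵐ ω ∂μ, ∃ l, Tendsto (fun n => min (φ (payoff V₀ S Y Z n ω)) 1) atTop (𝓝 l) := by
  have hsup : Supermartingale (fun n ω => min (φ (payoff V₀ S Y Z n ω)) 1) ℱ μ := by
    refine supermartingale_of_setIntegral_succ_le
      (fun n => (h.measurable_comp_payoff (fun v => min (φ v) 1) n).stronglyMeasurable)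
      (fun n => h.integrable_comp_payoff (fun v => min (φ v) 1) n) fun n A hA => ?_
    refine (h.setIntegral_min_succ_le hV₀ hφ n hA).trans (sub_le_self _ ?_)
    refine integral_nonneg fun ω => ?_
    simp only [Pi.zero_apply]
    split_ifs with hlt
    · exact hφ.drift_nonneg _ (le_payoff n ω) hlt
    · exact le_rfl
  have hbdd : ∀ n, eLpNorm ((-fun n ω => min (φ (payoff V₀ S Y Z n ω)) 1) n) 1 μ ≤
      (1 : NNReal) := fun n => by
    refine (eLpNorm_le_of_ae_bound (C := 1) (Eventually.of_forall fun ω => ?_)).trans ?_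
    · have := hφ.nonneg _ (le_payoff (S := S) (Y := Y) (Z := Z) n ω)
      simp only [Pi.neg_apply, norm_neg, Real.norm_eq_abs]
      rw [abs_of_nonneg (le_min this zero_le_one)]
      exact min_le_right _ _
    · simp
  filter_upwards [hsup.neg.exists_ae_tendsto_of_bdd hbdd] with ω hω
  obtain ⟨l, hl⟩ := hω
  exact ⟨-l, by simpa using hl.neg⟩

/-- The expected drifts telescope against the truncated function, which lies in `[0, 1]`. Their
total is at most `1`, so the random sum is almost surely finite. -/
lemma ae_summable_drift (h : IsRothErevGame μ ℱ V₀ S Y Z) (hV₀ : ∀ p, 0 < V₀ p)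
    (hφ : IsLyapunov V₀ φ D) :
    ∀ᵐ ω ∂μ, Summable fun n =>
      if φ (payoff V₀ S Y Z n ω) < 1 then D (payoff V₀ S Y Z n ω) else 0 := by
  set d : ℕ → Ω → ℝ := fun n ω =>
    if φ (payoff V₀ S Y Z n ω) < 1 then D (payoff V₀ S Y Z n ω) else 0 with hd
  have hd0 : ∀ n ω, 0 ≤ d n ω := fun n ω => by
    simp only [hd]
    split_ifs with hlt
    · exact hφ.drift_nonneg _ (le_payoff n ω) hlt
    · exact le_rfl
  have hdi : ∀ n, Integrable (d n) μ := fun n =>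
    h.integrable_comp_payoff (fun v => if φ v < 1 then D v else 0) n
  have hstep : ∀ n, ∑ k ∈ Finset.range n, ∫ ω, d k ω ∂μ ≤
      ∫ ω, min (φ (payoff V₀ S Y Z 0 ω)) 1 ∂μ - ∫ ω, min (φ (payoff V₀ S Y Z n ω)) 1 ∂μ := by
    intro n
    induction n with
    | zero => simp
    | succ n ih =>
      have := h.setIntegral_min_succ_le hV₀ hφ n MeasurableSet.univ
      simp only [setIntegral_univ] at this
      rw [Finset.sum_range_succ]
      simp only [hd] at ih ⊢
      linarith
  have hle : ∀ n, ∑ k ∈ Finset.range n, ∫ ω, d k ω ∂μ ≤ 1 := fun n => by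
    refine (hstep n).trans ?_
    have h1 : ∫ ω, min (φ (payoff V₀ S Y Z 0 ω)) 1 ∂μ ≤ ∫ _, (1 : ℝ) ∂μ :=
      integral_mono (h.integrable_comp_payoff (fun v => min (φ v) 1) 0) (integrable_const _)
        fun ω => min_le_right _ _
    have h2 : 0 ≤ ∫ ω, min (φ (payoff V₀ S Y Z n ω)) 1 ∂μ :=
      integral_nonneg fun ω => le_min (hφ.nonneg _ (le_payoff n ω)) zero_le_one
    simp only [integral_const, probReal_univ, smul_eq_mul, mul_one] at h1
    linarith
  have hfin : ∫⁻ ω, ∑' n, ENNReal.ofReal (d n ω) ∂μ ≠ ⊤ := by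
    rw [lintegral_tsum fun n => (hdi n).aestronglyMeasurable.aemeasurable.ennreal_ofReal]
    refine ne_top_of_le_ne_top ENNReal.one_ne_top ?_
    rw [ENNReal.tsum_eq_iSup_nat]
    refine iSup_le fun n => ?_
    have : ∀ k, ∫⁻ ω, ENNReal.ofReal (d k ω) ∂μ = ENNReal.ofReal (∫ ω, d k ω ∂μ) := fun k =>
      (ofReal_integral_eq_lintegral_ofReal (hdi k) (Eventually.of_forall (hd0 k))).symm
    simp only [this]
    rw [← ENNReal.ofReal_sum_of_nonneg fun k _ => integral_nonneg (hd0 k)]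
    exact ENNReal.ofReal_le_one.2 (hle n)
  have hmeas : AEMeasurable (fun ω => ∑' n, ENNReal.ofReal (d n ω)) μ :=
    AEMeasurable.tsum fun n => (hdi n).aestronglyMeasurable.aemeasurable.ennreal_ofReal
  filter_upwards [ae_lt_top' hmeas hfin] with ω hω
  have := ENNReal.summable_toReal hω.ne
  refine this.congr fun n => ?_
  exact ENNReal.toReal_ofReal (hd0 n ω)

/-- From a state where a Lyapunov function is small it stays small forever with positive
probability. -/
lemma measure_forall_lt_pos (h : IsRothErevGame μ ℱ V₀ S Y Z) (hV₀ : ∀ p, 0 < V₀ p)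
    (hφ : IsLyapunov V₀ φ D) {n₀ : ℕ} {v₀ : S₁ × S₂ → ℝ}
    (hpos : 0 < μ {ω | payoff V₀ S Y Z n₀ ω = v₀}) (hv₀ : φ v₀ < 1 / 4) :
    0 < μ {ω | ∀ n, n₀ ≤ n → φ (payoff V₀ S Y Z n ω) < 1 / 2} := by
  -- `A k` is the event of starting at `v₀` and staying confined for `k` further rounds.
  set A : ℕ → Set Ω := fun k =>
    {ω | payoff V₀ S Y Z n₀ ω = v₀ ∧ ∀ n, n₀ ≤ n → n ≤ n₀ + k →
      φ (payoff V₀ S Y Z n ω) < 1 / 2} with hAdef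
  set B : Set Ω := {ω | payoff V₀ S Y Z n₀ ω = v₀} with hB
  set θ : ℕ → Ω → ℝ := fun n ω => min (φ (payoff V₀ S Y Z n ω)) 1 with hθ
  have hBm : MeasurableSet[ℱ n₀] B := h.measurable_payoff n₀ (measurableSet_singleton v₀)
  have hlt : ∀ n, MeasurableSet[ℱ n] {ω | φ (payoff V₀ S Y Z n ω) < 1 / 2} := fun n =>
    h.measurable_comp_payoff φ n measurableSet_Iio
  have hA0 : A 0 = B := by
    ext ω
    simp only [hAdef, hB, Set.mem_ofPred_eq, add_zero]
    refine ⟨fun H => H.1, fun H => ⟨H, fun n h1 h2 => ?_⟩⟩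
    rw [le_antisymm h2 h1, H]
    linarith
  have hAs : ∀ k, A (k + 1) = A k ∩ {ω | φ (payoff V₀ S Y Z (n₀ + k + 1) ω) < 1 / 2} := by
    intro k
    ext ω
    simp only [hAdef, Set.mem_ofPred_eq, Set.mem_inter_iff]
    constructor
    · rintro ⟨h1, h2⟩
      exact ⟨⟨h1, fun n hn hn' => h2 n hn (by omega)⟩, h2 _ (by omega) (by omega)⟩
    · rintro ⟨⟨h1, h2⟩, h3⟩
      refine ⟨h1, fun n hn hn' => ?_⟩
      rcases Nat.lt_or_ge n (n₀ + k + 1) with h4 | h4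
      · exact h2 n hn (by omega)
      · rw [show n = n₀ + k + 1 by omega]; exact h3
  have hAm : ∀ k, MeasurableSet[ℱ (n₀ + k)] (A k) := by
    intro k
    induction k with
    | zero => rw [hA0]; exact hBm
    | succ k ih =>
      rw [hAs]
      exact (ℱ.mono (Nat.le_succ _) _ ih).inter (hlt _)
  have hAm' : ∀ k, MeasurableSet (A k) := fun k => ℱ.le _ _ (hAm k)
  have hθi : ∀ n, Integrable (θ n) μ := fun n =>
    h.integrable_comp_payoff (fun v => min (φ v) 1) n
  -- A maximal inequality by induction: mass that has escaped is counted with the value at least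
  -- `1/2` of `θ` at the exit, and the total never exceeds the initial `1/4`. Dropping the
  -- nonnegative integral leaves at least half of `B` confined.
  have hkey : ∀ k, ∫ ω in A k, θ (n₀ + k) ω ∂μ + 1 / 2 * (μ.real B - μ.real (A k)) ≤
      1 / 4 * μ.real B := by
    intro k
    induction k with
    | zero =>
      rw [hA0, sub_self, mul_zero, add_zero]
      have : ∫ ω in B, θ (n₀ + 0) ω ∂μ ≤ ∫ ω in B, (1 / 4 : ℝ) ∂μ := by
        refine setIntegral_mono_on (hθi _).integrableOn (integrable_const _).integrableOn
          (ℱ.le _ _ hBm) fun ω hω => ?_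
        have hω' : payoff V₀ S Y Z n₀ ω = v₀ := hω
        simp only [hθ, add_zero, hω']
        exact (min_le_left _ _).trans hv₀.le
      rw [setIntegral_const, smul_eq_mul] at this
      linarith
    | succ k ih =>
      have h1 : ∫ ω in A k, θ (n₀ + k + 1) ω ∂μ ≤ ∫ ω in A k, θ (n₀ + k) ω ∂μ := by
        refine (h.setIntegral_min_succ_le hV₀ hφ (n₀ + k) (hAm k)).trans (sub_le_self _ ?_)
        refine integral_nonneg fun ω => ?_
        simp only [Pi.zero_apply]
        split_ifs with hlt
        · exact hφ.drift_nonneg _ (le_payoff _ ω) hlt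
        · exact le_rfl
      have hsub : A (k + 1) ⊆ A k := by rw [hAs]; exact Set.inter_subset_left
      have h2 : ∫ ω in A (k + 1), θ (n₀ + k + 1) ω ∂μ +
          ∫ ω in A k \ A (k + 1), θ (n₀ + k + 1) ω ∂μ = ∫ ω in A k, θ (n₀ + k + 1) ω ∂μ := by
        rw [← setIntegral_union Set.disjoint_sdiff_right ((hAm' k).diff (hAm' _))
          (hθi _).integrableOn (hθi _).integrableOn, Set.union_sdiff_cancel hsub]
      have h3 : 1 / 2 * μ.real (A k \ A (k + 1)) ≤
          ∫ ω in A k \ A (k + 1), θ (n₀ + k + 1) ω ∂μ := by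
        have : ∫ ω in A k \ A (k + 1), (1 / 2 : ℝ) ∂μ ≤
            ∫ ω in A k \ A (k + 1), θ (n₀ + k + 1) ω ∂μ := by
          refine setIntegral_mono_on (integrable_const _).integrableOn (hθi _).integrableOn
            ((hAm' k).diff (hAm' _)) fun ω hω => ?_
          have : ¬ φ (payoff V₀ S Y Z (n₀ + k + 1) ω) < 1 / 2 := fun hc =>
            hω.2 (by rw [hAs]; exact ⟨hω.1, hc⟩)
          exact le_min (not_lt.1 this) (by norm_num)
        rw [setIntegral_const, smul_eq_mul] at this
        linarith
      have h4 : μ.real (A k \ A (k + 1)) = μ.real (A k) - μ.real (A (k + 1)) :=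
        measureReal_sdiff hsub (hAm' _)
      rw [← add_assoc n₀ k 1]
      rw [h4] at h3
      linarith
  have hge : ∀ k, μ B / 2 ≤ μ (A k) := by
    intro k
    have h0 : 0 ≤ ∫ ω in A k, θ (n₀ + k) ω ∂μ :=
      integral_nonneg fun ω => le_min (hφ.nonneg _ (le_payoff _ ω)) zero_le_one
    have h1 : μ.real B / 2 ≤ μ.real (A k) := by linarith [hkey k]
    rw [← ENNReal.toReal_le_toReal (ENNReal.div_ne_top (measure_ne_top _ _) two_ne_zero)
      (measure_ne_top _ _), ENNReal.toReal_div]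
    simpa [Measure.real] using h1
  have hanti : Antitone A := antitone_nat_of_succ_le fun k => by
    rw [hAs]; exact Set.inter_subset_left
  have hlim : μ B / 2 ≤ μ (⋂ k, A k) :=
    ge_of_tendsto' (tendsto_measure_iInter_atTop (fun k => (hAm' k).nullMeasurableSet) hanti
      ⟨0, measure_ne_top _ _⟩) hge
  refine (ENNReal.half_pos hpos.ne').trans_le (hlim.trans (measure_mono fun ω hω n hn => ?_))
  rw [Set.mem_iInter] at hω
  exact (hω (n - n₀)).2 n hn (by omega)

lemma measure_payoff_succ_pos (h : IsRothErevGame μ ℱ V₀ S Y Z) {n : ℕ} {v : S₁ × S₂ → ℝ}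
    (hv : ∀ p, 0 < v p) (hpos : 0 < μ {ω | payoff V₀ S Y Z n ω = v}) (p : S₁ × S₂) :
    0 < μ {ω | payoff V₀ S Y Z (n + 1) ω = v + Pi.single p 1} := by
  classical
  -- The indicator of the target turns the one-round formula into a transition probability, which is
  -- positive because all payoffs are.
  set φ : (S₁ × S₂ → ℝ) → ℝ := fun w => if w = v + Pi.single p 1 then 1 else 0 with hφ
  have hA : MeasurableSet[ℱ n] {ω | payoff V₀ S Y Z n ω = v} :=
    h.measurable_payoff n (measurableSet_singleton v)
  have hstep := h.setIntegral_comp_payoff_succ φ n hA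
  have hR : ∫ ω in {ω | payoff V₀ S Y Z n ω = v},
      φ (payoff V₀ S Y Z n ω) + generator φ (payoff V₀ S Y Z n ω) ∂μ =
      μ.real {ω | payoff V₀ S Y Z n ω = v} * (φ v + generator φ v) := by
    rw [← smul_eq_mul, ← setIntegral_const]
    refine setIntegral_congr_fun (ℱ.le n _ hA) fun ω hω => ?_
    have : payoff V₀ S Y Z n ω = v := hω
    simp only [this]
  have hne : v ≠ v + Pi.single p 1 := fun hc => by
    have := congrFun hc p
    simp at this
  have hprob : ∀ r, 0 < successProb v r := fun r => by
    have h1 : 0 < stateMass v r.1 :=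
      Finset.sum_pos (fun _ _ => hv _) ⟨r.2, Finset.mem_univ _⟩
    have h2 : 0 < signalMass v r.2 :=
      Finset.sum_pos (fun _ _ => hv _) ⟨r.1, Finset.mem_univ _⟩
    have h3 : 0 < (Fintype.card S₁ : ℝ) := Nat.cast_pos.2 (Fintype.card_pos_iff.2 ⟨r.1⟩)
    have := hv (r.1, r.2)
    unfold successProb roundProb
    positivity
  have hgen : 0 < φ v + generator φ v := by
    have h0 : φ v = 0 := if_neg hne
    have h1 : generator φ v = ∑ r, successProb v r * φ (v + Pi.single r 1) := by
      simp [generator, h0]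
    rw [h0, zero_add, h1]
    refine Finset.sum_pos' (fun r _ => mul_nonneg (hprob r).le ?_) ⟨p, Finset.mem_univ _, ?_⟩
    · simp only [hφ]; split_ifs <;> norm_num
    · simpa [hφ] using hprob p
  rw [hR] at hstep
  have hpos' : 0 < μ.real {ω | payoff V₀ S Y Z n ω = v} :=
    ENNReal.toReal_pos hpos.ne' (measure_ne_top _ _)
  by_contra hzero
  have hz : μ {ω | payoff V₀ S Y Z (n + 1) ω = v + Pi.single p 1} = 0 := by simpa using hzero
  have : ∫ ω in {ω | payoff V₀ S Y Z n ω = v}, φ (payoff V₀ S Y Z (n + 1) ω) ∂μ = 0 := by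
    refine integral_eq_zero_of_ae (ae_restrict_of_ae ?_)
    have : ∀ᵐ ω ∂μ, payoff V₀ S Y Z (n + 1) ω ≠ v + Pi.single p 1 := by
      rw [ae_iff]; simpa using hz
    filter_upwards [this] with ω hω
    exact if_neg hω
  have hp := mul_pos hpos' hgen
  linarith

/-- Every finite sequence of reinforcements has positive probability. -/
lemma exists_measure_payoff_eq_pos (h : IsRothErevGame μ ℱ V₀ S Y Z) (hV₀ : ∀ p, 0 < V₀ p)
    (s : Multiset (S₁ × S₂)) :
    0 < μ {ω | payoff V₀ S Y Z s.card ω = V₀ + fun p => (s.count p : ℝ)} := by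
  induction s using Multiset.induction_on with
  | empty =>
    have : {ω | payoff V₀ S Y Z (0 : Multiset (S₁ × S₂)).card ω =
        V₀ + fun p => ((0 : Multiset (S₁ × S₂)).count p : ℝ)} = Set.univ := by
      ext ω
      simp only [Multiset.card_zero, Set.mem_ofPred_eq, Set.mem_univ, iff_true]
      funext p
      simp [payoff]
    rw [this]
    simp
  | cons p s ih =>
    have := h.measure_payoff_succ_pos
      (fun r => add_pos_of_pos_of_nonneg (hV₀ r) (Nat.cast_nonneg (s.count r))) ih p
    convert this using 5 with ω
    · simp
    · funext r
      simp only [Pi.add_apply, Multiset.count_cons, Pi.single_apply]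
      split_ifs <;> simp [add_assoc]

end IsRothErevGame

end Lyapunov

/-! ### Star forests -/

section StarForest

variable [DecidableEq S₁] [DecidableEq S₂]

/-- A set of pairs which, seen as the edges of a bipartite graph, covers all vertices and
has only stars as connected components. -/
structure IsStarForest (E : Finset (S₁ × S₂)) : Prop where
  leaf : ∀ e ∈ E, (∀ e' ∈ E, e'.1 = e.1 → e' = e) ∨ ∀ e' ∈ E, e'.2 = e.2 → e' = e
  state : ∀ i, ∃ e ∈ E, e.1 = i
  signal : ∀ j, ∃ e ∈ E, e.2 = j

/-- The edges that share a vertex with `e`. -/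
def star (E : Finset (S₁ × S₂)) (e : S₁ × S₂) : Finset (S₁ × S₂) :=
  E.filter fun e' => e'.1 = e.1 ∨ e'.2 = e.2

/-- The total payoff of the star of `e`. -/
def starMass (E : Finset (S₁ × S₂)) (v : S₁ × S₂ → ℝ) (e : S₁ × S₂) : ℝ := ∑ r ∈ star E e, v r

/-- The share of `e` in the total payoff of its star. -/
def share (E : Finset (S₁ × S₂)) (v : S₁ × S₂ → ℝ) (e : S₁ × S₂) : ℝ := v e / starMass E v e

variable {E : Finset (S₁ × S₂)} {e e' : S₁ × S₂} {v : S₁ × S₂ → ℝ} {B : ℝ}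

lemma self_mem_star (he : e ∈ E) : e ∈ star E e := by simp [star, he]

lemma star_subset : star E e ⊆ E := Finset.filter_subset _ _

/-- In a star forest, sharing a vertex is an equivalence relation on edges: a chain of two such
relations through different kinds of vertices would violate the leaf condition. -/
lemma IsStarForest.star_eq (hE : IsStarForest E) (he : e ∈ E) (he' : e' ∈ star E e) :
    star E e' = star E e := by
  obtain ⟨h1, h2⟩ := Finset.mem_filter.1 he'
  ext r
  simp only [star, Finset.mem_filter, and_congr_right_iff]
  intro hr
  have a1 := hE.leaf e he
  have a2 := hE.leaf e' h1
  have a3 := hE.leaf r hr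
  grind

lemma IsStarForest.starMass_eq (hE : IsStarForest E) (he : e ∈ E) (he' : e' ∈ star E e)
    (v : S₁ × S₂ → ℝ) : starMass E v e' = starMass E v e := by
  rw [starMass, hE.star_eq he he', starMass]

lemma IsStarForest.disjoint_star (hE : IsStarForest E) (he : e ∈ E) (he' : e' ∈ E)
    (h : e' ∉ star E e) : Disjoint (star E e) (star E e') := by
  rw [Finset.disjoint_left]
  intro r hr hr'
  have := (hE.star_eq he hr).symm.trans (hE.star_eq he' hr')
  exact h (this ▸ self_mem_star he')

lemma le_starMass (hv : ∀ p, 0 ≤ v p) (he : e ∈ E) : v e ≤ starMass E v e :=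
  Finset.single_le_sum (fun p _ => hv p) (self_mem_star he)

lemma stateMass_eq_sum_filter (v : S₁ × S₂ → ℝ) (i : S₁) :
    stateMass v i = ∑ p with p.1 = i, v p := by
  rw [stateMass, Finset.sum_filter, Fintype.sum_prod_type, Finset.sum_eq_single i]
  · simp
  · intro k _ hk; simp [hk]
  · simp

lemma signalMass_eq_sum_filter (v : S₁ × S₂ → ℝ) (j : S₂) :
    signalMass v j = ∑ p with p.2 = j, v p := by
  rw [signalMass, Finset.sum_filter, Fintype.sum_prod_type_right, Finset.sum_eq_single j]
  · simp
  · intro k _ hk; simp [hk]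
  · simp

lemma sum_filter_bounds (hv : ∀ p, 0 ≤ v p) (hB : ∑ p ∈ Eᶜ, v p ≤ B) (P : S₁ × S₂ → Prop)
    [DecidablePred P] :
    ∑ p ∈ E with P p, v p ≤ ∑ p with P p, v p ∧
      ∑ p with P p, v p ≤ ∑ p ∈ E with P p, v p + B := by
  have h1 : ∑ p with P p, v p = ∑ p ∈ E with P p, v p + ∑ p ∈ Eᶜ with P p, v p := by
    simp only [Finset.sum_filter]
    rw [Finset.sum_add_sum_compl]
  have h2 : ∑ p ∈ Eᶜ with P p, v p ≤ ∑ p ∈ Eᶜ, v p :=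
    Finset.sum_le_sum_of_subset_of_nonneg (Finset.filter_subset _ _) fun p _ _ => hv p
  have h3 : 0 ≤ ∑ p ∈ Eᶜ with P p, v p := Finset.sum_nonneg fun p _ => hv p
  constructor <;> linarith

/-- Up to the payoffs outside of the forest, one end of an edge has the payoff of the edge and the
other end has the payoff of its star. -/
lemma IsStarForest.mass_mul_mass_bounds (hE : IsStarForest E) (hv : ∀ p, 0 ≤ v p)
    (hB : ∑ p ∈ Eᶜ, v p ≤ B) (he : e ∈ E) :
    v e * starMass E v e ≤ stateMass v e.1 * signalMass v e.2 ∧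
      stateMass v e.1 * signalMass v e.2 ≤ (v e + B) * (starMass E v e + B) := by
  obtain ⟨a1, a2⟩ := sum_filter_bounds hv hB fun p => p.1 = e.1
  obtain ⟨b1, b2⟩ := sum_filter_bounds hv hB fun p => p.2 = e.2
  rw [← stateMass_eq_sum_filter] at a1 a2
  rw [← signalMass_eq_sum_filter] at b1 b2
  have hB0 : 0 ≤ B := (Finset.sum_nonneg fun p _ => hv p).trans hB
  have hC : 0 ≤ starMass E v e := Finset.sum_nonneg fun p _ => hv p
  have he0 := hv e
  rcases hE.leaf e he with h | h
  · have h1 : E.filter (fun p => p.1 = e.1) = {e} := by ext r; grind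
    have h2 : E.filter (fun p => p.2 = e.2) = star E e := by ext r; grind [star]
    rw [h1, Finset.sum_singleton] at a1 a2
    rw [h2] at b1 b2
    change starMass E v e ≤ _ at b1
    change _ ≤ starMass E v e + _ at b2
    constructor
    · exact mul_le_mul a1 b1 hC (he0.trans a1)
    · gcongr
      linarith
  · have h1 : E.filter (fun p => p.2 = e.2) = {e} := by ext r; grind
    have h2 : E.filter (fun p => p.1 = e.1) = star E e := by ext r; grind [star]
    rw [h1, Finset.sum_singleton] at b1 b2
    rw [h2] at a1 a2
    change starMass E v e ≤ _ at a1
    change _ ≤ starMass E v e + _ at a2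
    rw [mul_comm (v e), mul_comm (v e + B)]
    constructor
    · exact mul_le_mul a1 b1 he0 (hC.trans a1)
    · gcongr
      linarith

lemma IsStarForest.mass_mul_mass_eq (hE : IsStarForest E) (hv : ∀ p, 0 ≤ v p)
    (h0 : ∀ p, p ∉ E → v p = 0) (he : e ∈ E) :
    stateMass v e.1 * signalMass v e.2 = v e * starMass E v e := by
  have hB : ∑ p ∈ Eᶜ, v p ≤ 0 :=
    (Finset.sum_eq_zero fun p hp => h0 p (Finset.mem_compl.1 hp)).le
  obtain ⟨h1, h2⟩ := hE.mass_mul_mass_bounds hv hB he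
  rw [add_zero, add_zero] at h2
  exact le_antisymm h2 h1

/-- The sum of the shares is the number of stars. -/
lemma IsStarForest.sum_share (hE : IsStarForest E) (hv : ∀ p ∈ E, 0 < v p) :
    ∑ e ∈ E, share E v e = ∑ e ∈ E, 1 / ((star E e).card : ℝ) := by
  have hcard : ∀ e ∈ E, ((star E e).card : ℝ) ≠ 0 := fun e he =>
    Nat.cast_ne_zero.2 (Finset.card_ne_zero_of_mem (self_mem_star he))
  have hmass : ∀ e ∈ E, starMass E v e ≠ 0 := fun e he =>
    (Finset.sum_pos (fun p hp => hv p (star_subset hp)) ⟨e, self_mem_star he⟩).ne'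
  have hsymm : ∀ e ∈ E, ∀ r ∈ star E e, e ∈ star E r := fun e he r hr => by
    rw [hE.star_eq he hr]; exact self_mem_star he
  -- Spread each share evenly over its star and exchange the sums. Both the weight and the star mass
  -- are constant on a star, whose shares add up to `1`.
  calc ∑ e ∈ E, share E v e
      = ∑ e ∈ E, ∑ r ∈ star E e, 1 / ((star E e).card : ℝ) * share E v e := by
        refine Finset.sum_congr rfl fun e he => ?_
        rw [Finset.sum_const, nsmul_eq_mul, ← mul_assoc, mul_one_div_cancel (hcard e he), one_mul]
    _ = ∑ r ∈ E, ∑ e ∈ star E r, 1 / ((star E e).card : ℝ) * share E v e := by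
        refine Finset.sum_comm' fun e r => ⟨fun h => ?_, fun h => ?_⟩
        · exact ⟨hsymm e h.1 r h.2, star_subset h.2⟩
        · exact ⟨star_subset h.1, hsymm r h.2 e h.1⟩
    _ = ∑ r ∈ E, 1 / ((star E r).card : ℝ) := by
        refine Finset.sum_congr rfl fun r hr => ?_
        have : ∀ e ∈ star E r, 1 / ((star E e).card : ℝ) * share E v e =
            1 / ((star E r).card : ℝ) / starMass E v r * v e := fun e he => by
          rw [hE.star_eq hr he, share, hE.starMass_eq hr he]
          ring
        rw [Finset.sum_congr rfl this, ← Finset.mul_sum]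
        exact div_mul_cancel₀ _ (hmass r hr)

/-! ### Rates of reinforcement near a star forest -/

lemma successProb_eq (v : S₁ × S₂ → ℝ) (p : S₁ × S₂) :
    successProb v p = v p ^ 2 / (Fintype.card S₁ * (stateMass v p.1 * signalMass v p.2)) := by
  rw [successProb, roundProb]
  field_simp

/-- Bound Receiver's probability by `1`; Sender's probabilities, averaged over the states, sum to at
most `1`. -/
lemma sum_successProb_le_one [Nonempty S₁] (hv : ∀ p, 0 < v p) : ∑ p, successProb v p ≤ 1 := by
  have hM : 0 < (Fintype.card S₁ : ℝ) := Nat.cast_pos.2 Fintype.card_pos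
  have hle : ∀ p : S₁ × S₂, successProb v p ≤ 1 / (Fintype.card S₁ : ℝ) * (v p / stateMass v p.1) :=
    fun p => by
      rw [successProb, roundProb]
      refine mul_le_of_le_one_right ?_ ?_
      · have : 0 ≤ stateMass v p.1 := Finset.sum_nonneg fun _ _ => (hv _).le
        have := (hv p).le
        positivity
      · exact div_le_one_of_le₀ (Finset.single_le_sum (f := fun i => v (i, p.2))
          (fun _ _ => (hv _).le) (Finset.mem_univ p.1)) (Finset.sum_nonneg fun _ _ => (hv _).le)
  refine (Finset.sum_le_sum fun p _ => hle p).trans ?_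
  rw [← Finset.mul_sum, Fintype.sum_prod_type]
  have : ∀ i : S₁, ∑ j : S₂, v (i, j) / stateMass v i ≤ 1 := fun i => by
    rw [← Finset.sum_div]
    exact div_self_le_one _
  calc 1 / (Fintype.card S₁ : ℝ) * ∑ i, ∑ j : S₂, v (i, j) / stateMass v i
      ≤ 1 / (Fintype.card S₁ : ℝ) * ∑ _i : S₁, 1 := by
        gcongr with i _
        exact this i
    _ = 1 := by simp

/-- The error in the reinforcement rates of a star forest if the payoffs outside of it are at
most `B`. -/
def rateError (E : Finset (S₁ × S₂)) (B : ℝ) : ℝ := E.card * (2 * B + B ^ 2)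

/-- The payoffs `v` are concentrated on the star forest `E`. -/
structure IsConcentrated (E : Finset (S₁ × S₂)) (B δ : ℝ) (v : S₁ × S₂ → ℝ) : Prop where
  pos : ∀ p, 0 < v p
  off_le : ∑ p ∈ Eᶜ, v p ≤ B
  one_le : ∀ e ∈ E, 1 ≤ starMass E v e
  error_le : ∀ e ∈ E, 2 * rateError E B ≤ starMass E v e
  le_share : ∀ e ∈ E, δ ≤ share E v e

namespace IsConcentrated

variable {δ : ℝ}

lemma bound_nonneg (hg : IsConcentrated E B δ v) : 0 ≤ B :=
  (Finset.sum_nonneg fun p _ => (hg.pos p).le).trans hg.off_le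

lemma rateError_nonneg (hg : IsConcentrated E B δ v) : 0 ≤ rateError E B := by
  have := hg.bound_nonneg
  unfold rateError
  positivity

/-- The urn rate `v e / (M c)` of an edge in a star of mass `c`, with the error caused by the
payoffs outside the forest. It comes from `mass_mul_mass_bounds` and `successProb_eq`. -/
lemma successProb_bounds (hg : IsConcentrated E B δ v) (hE : IsStarForest E) (he : e ∈ E) :
    v e - (2 * B + B ^ 2) ≤ Fintype.card S₁ * starMass E v e * successProb v e ∧
      Fintype.card S₁ * starMass E v e * successProb v e ≤ v e := by
  have hM : 0 < (Fintype.card S₁ : ℝ) := Nat.cast_pos.2 (Fintype.card_pos_iff.2 ⟨e.1⟩)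
  obtain ⟨h1, h2⟩ := hE.mass_mul_mass_bounds (fun p => (hg.pos p).le) hg.off_le he
  have hu := hg.pos e
  have hc := hg.one_le e he
  have huc := le_starMass (fun p => (hg.pos p).le) he
  have hB := hg.bound_nonneg
  rw [successProb_eq]
  generalize stateMass v e.1 * signalMass v e.2 = m at *
  generalize starMass E v e = c at *
  generalize v e = u at *
  have hc0 : 0 < c := by linarith
  have hm : 0 < m := (mul_pos hu hc0).trans_le h1
  have heq : (Fintype.card S₁ : ℝ) * c * (u ^ 2 / (Fintype.card S₁ * m)) = c * u ^ 2 / m := by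
    field_simp
  rw [heq]
  constructor
  · rw [le_div_iff₀ hm]
    -- Expand `(u + B) * (c + B)` and use `u ≤ c` and `1 ≤ c`; hence the form of `rateError`.
    have h3 : m ≤ u * c + (2 * B + B ^ 2) * c := by
      nlinarith [mul_nonneg hB (sub_nonneg.2 huc), mul_nonneg (sq_nonneg B) (sub_nonneg.2 hc)]
    have h4 : 0 ≤ (2 * B + B ^ 2) := by positivity
    nlinarith [mul_le_mul_of_nonneg_left h3 hu.le, mul_le_mul_of_nonneg_left h1 h4]
  · rw [div_le_iff₀ hm]
    nlinarith

/-- Summing the edge rates cancels the star mass: each star gains at rate nearly `1 / M`, which is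
what equalises the stars. -/
lemma sum_star_successProb_bounds (hg : IsConcentrated E B δ v) (hE : IsStarForest E)
    (he : e ∈ E) :
    starMass E v e - rateError E B ≤
        Fintype.card S₁ * starMass E v e * ∑ p ∈ star E e, successProb v p ∧
      Fintype.card S₁ * starMass E v e * ∑ p ∈ star E e, successProb v p ≤ starMass E v e := by
  have hB := hg.bound_nonneg
  have hb : ∀ p ∈ star E e, v p - (2 * B + B ^ 2) ≤
      Fintype.card S₁ * starMass E v e * successProb v p ∧
      Fintype.card S₁ * starMass E v e * successProb v p ≤ v p := fun p hp => by
    rw [← hE.starMass_eq he hp]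
    exact hg.successProb_bounds hE (star_subset hp)
  rw [Finset.mul_sum]
  constructor
  · refine le_trans ?_ (Finset.sum_le_sum fun p hp => (hb p hp).1)
    rw [Finset.sum_sub_distrib, Finset.sum_const, nsmul_eq_mul, rateError]
    refine sub_le_sub le_rfl ?_
    gcongr
    exact star_subset
  · exact Finset.sum_le_sum fun p hp => (hb p hp).2

end IsConcentrated

end StarForest

/-! ### Drift estimates near a star forest -/

section Drift

variable [DecidableEq S₁] [DecidableEq S₂]

variable {E : Finset (S₁ × S₂)} {e e' : S₁ × S₂} {v : S₁ × S₂ → ℝ} {B δ : ℝ}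

lemma generator_add (φ ψ : (S₁ × S₂ → ℝ) → ℝ) (v : S₁ × S₂ → ℝ) :
    generator (fun v => φ v + ψ v) v = generator φ v + generator ψ v := by
  simp only [generator, ← Finset.sum_add_distrib]
  exact Finset.sum_congr rfl fun p _ => by ring

lemma generator_const_mul (c : ℝ) (φ : (S₁ × S₂ → ℝ) → ℝ) (v : S₁ × S₂ → ℝ) :
    generator (fun v => c * φ v) v = c * generator φ v := by
  simp only [generator, Finset.mul_sum]
  exact Finset.sum_congr rfl fun p _ => by ring

lemma generator_sum {ι : Type*} (s : Finset ι) (φ : ι → (S₁ × S₂ → ℝ) → ℝ) (v : S₁ × S₂ → ℝ) :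
    generator (fun v => ∑ i ∈ s, φ i v) v = ∑ i ∈ s, generator (φ i) v := by
  simp only [generator, ← Finset.sum_sub_distrib, Finset.mul_sum]
  exact Finset.sum_comm

lemma generator_apply_sub (c : ℝ) (p : S₁ × S₂) (v : S₁ × S₂ → ℝ) :
    generator (fun v => v p - c) v = successProb v p := by
  simp only [generator]
  rw [Finset.sum_eq_single p]
  · simp
  · intro r _ hr; simp [hr.symm]
  · simp

/-- Discrete Itô formula: the second-order term is at most the squared jump size. -/
lemma generator_sq_le [Nonempty S₁] (hv : ∀ p, 0 < v p) (u : (S₁ × S₂ → ℝ) → ℝ) (a : ℝ) {d : ℝ}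
    (hd : ∀ p, |u (v + Pi.single p 1) - u v| ≤ d) :
    generator (fun v => (u v - a) ^ 2) v ≤ 2 * (u v - a) * generator u v + d ^ 2 := by
  have h1 : generator (fun v => (u v - a) ^ 2) v = 2 * (u v - a) * generator u v +
      ∑ p, successProb v p * (u (v + Pi.single p 1) - u v) ^ 2 := by
    simp only [generator, Finset.mul_sum, ← Finset.sum_add_distrib]
    exact Finset.sum_congr rfl fun p _ => by ring
  have h2 : ∑ p, successProb v p * (u (v + Pi.single p 1) - u v) ^ 2 ≤
      ∑ p, successProb v p * d ^ 2 := by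
    refine Finset.sum_le_sum fun p _ => mul_le_mul_of_nonneg_left ?_
      (successProb_nonneg (fun r => (hv r).le) p)
    rw [← sq_abs]
    gcongr
    exact hd p
  rw [← Finset.sum_mul] at h2
  have h3 := mul_le_mul_of_nonneg_right (sum_successProb_le_one hv) (sq_nonneg d)
  linarith

lemma starMass_add_single (v : S₁ × S₂ → ℝ) (p e : S₁ × S₂) :
    starMass E (v + Pi.single p 1) e = starMass E v e + if p ∈ star E e then 1 else 0 := by
  simp only [starMass, Pi.add_apply, Finset.sum_add_distrib, Pi.single_apply, Finset.sum_ite_eq']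

lemma generator_comp_starMass (g : ℝ → ℝ) (v : S₁ × S₂ → ℝ) (e : S₁ × S₂) :
    generator (fun v => g (starMass E v e)) v =
      (∑ p ∈ star E e, successProb v p) * (g (starMass E v e + 1) - g (starMass E v e)) := by
  simp only [generator, starMass_add_single]
  rw [Finset.sum_mul, ← Finset.sum_subset (Finset.subset_univ (star E e))]
  · exact Finset.sum_congr rfl fun p hp => by rw [if_pos hp]
  · intro p _ hp
    rw [if_neg hp, add_zero, sub_self, mul_zero]

lemma generator_comp_starMass_starMass (hE : IsStarForest E) (he : e ∈ E) (he' : e' ∈ E)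
    (hne : e' ∉ star E e) (g : ℝ → ℝ → ℝ) (v : S₁ × S₂ → ℝ) :
    generator (fun v => g (starMass E v e) (starMass E v e')) v =
      (∑ p ∈ star E e, successProb v p) *
          (g (starMass E v e + 1) (starMass E v e') - g (starMass E v e) (starMass E v e')) +
        (∑ p ∈ star E e', successProb v p) *
          (g (starMass E v e) (starMass E v e' + 1) - g (starMass E v e) (starMass E v e')) := by
  have hdisj := hE.disjoint_star he he' hne
  simp only [generator, starMass_add_single]
  rw [Finset.sum_mul, Finset.sum_mul,
    ← Finset.sum_subset (Finset.subset_univ (star E e ∪ star E e')), Finset.sum_union hdisj]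
  · congr 1
    · refine Finset.sum_congr rfl fun p hp => ?_
      rw [if_pos hp, if_neg (Finset.disjoint_left.1 hdisj hp), add_zero]
    · refine Finset.sum_congr rfl fun p hp => ?_
      rw [if_pos hp, if_neg (Finset.disjoint_right.1 hdisj hp), add_zero]
  · intro p _ hp
    rw [Finset.mem_union, not_or] at hp
    rw [if_neg hp.1, if_neg hp.2, add_zero, add_zero, sub_self, mul_zero]

/-- The numerator vanishes when an edge is chosen within its star proportionally to its payoff, as
in a Pólya urn. Only the error of the rates contributes to the drift. -/
lemma generator_share (he : e ∈ E) (v : S₁ × S₂ → ℝ) (hc : 0 < starMass E v e) :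
    generator (fun v => share E v e) v =
      (successProb v e * starMass E v e - v e * ∑ p ∈ star E e, successProb v p) /
        (starMass E v e * (starMass E v e + 1)) := by
  have hterm : ∀ p, successProb v p * (share E (v + Pi.single p 1) e - share E v e) =
      (if p ∈ star E e then
        successProb v p * (v e / (starMass E v e + 1) - v e / starMass E v e) else 0) +
      if e = p then successProb v p / (starMass E v e + 1) else 0 := by
    intro p
    simp only [share, starMass_add_single, Pi.add_apply, Pi.single_apply]
    by_cases h : e = p
    · subst h
      simp only [if_pos (self_mem_star he), if_true]
      ring
    · simp only [if_neg h]
      split_ifs <;> ring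
  simp only [generator, hterm, Finset.sum_add_distrib, Finset.sum_ite_eq, Finset.mem_univ,
    if_true]
  rw [← Finset.sum_filter, Finset.filter_univ_mem, ← Finset.sum_mul]
  field_simp
  ring

/-! ### Drift of inverse masses and of shares -/

namespace IsConcentrated

lemma starMass_pos (hg : IsConcentrated E B δ v) (he : e ∈ E) : 0 < starMass E v e :=
  one_pos.trans_le (hg.one_le e he)

lemma share_mem_Icc (hg : IsConcentrated E B δ v) (he : e ∈ E) : share E v e ∈ Set.Icc 0 1 :=
  ⟨div_nonneg (hg.pos e).le (hg.starMass_pos he).le,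
    div_le_one_of_le₀ (le_starMass (fun p => (hg.pos p).le) he) (hg.starMass_pos he).le⟩

/-- The source of all negative drift: the mass grows by one at rate at least `1 / (2 M)`, and each
such step lowers the inverse by `1 / (c (c + 1)) ≥ 1 / (2 c ^ 2)`. -/
lemma generator_inv_starMass_le (hg : IsConcentrated E B δ v) (hE : IsStarForest E) (he : e ∈ E) :
    generator (fun v => 1 / starMass E v e) v ≤
      -(1 / (4 * Fintype.card S₁) * (1 / starMass E v e ^ 2)) := by
  have hM : 0 < (Fintype.card S₁ : ℝ) := Nat.cast_pos.2 (Fintype.card_pos_iff.2 ⟨e.1⟩)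
  rw [generator_comp_starMass (fun c => 1 / c)]
  have h1 := (hg.sum_star_successProb_bounds hE he).1
  have h2 := hg.error_le e he
  have h3 := hg.one_le e he
  have hc := hg.starMass_pos he
  generalize ∑ p ∈ star E e, successProb v p = P at *
  generalize starMass E v e = c at *
  have hP : 1 / (2 * Fintype.card S₁) ≤ P := by
    rw [div_le_iff₀ (by positivity)]
    have : c * 1 ≤ c * (P * (2 * Fintype.card S₁)) := by linarith
    exact le_of_mul_le_mul_left this hc
  have h4 : 1 / (c + 1) - 1 / c = -(1 / (c * (c + 1))) := by
    field_simp
    ring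
  have h5 : 1 / (2 * c ^ 2) ≤ 1 / (c * (c + 1)) :=
    one_div_le_one_div_of_le (by positivity) (by nlinarith)
  have h6 : 1 / (2 * (Fintype.card S₁ : ℝ)) * (1 / (2 * c ^ 2)) ≤ P * (1 / (c * (c + 1))) :=
    mul_le_mul hP h5 (by positivity) (le_trans (by positivity) hP)
  have h7 : 1 / (2 * (Fintype.card S₁ : ℝ)) * (1 / (2 * c ^ 2)) =
      1 / (4 * Fintype.card S₁) * (1 / c ^ 2) := by
    field_simp
    norm_num
  rw [h4, mul_neg, ← h7]
  exact neg_le_neg h6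

lemma abs_generator_share_le (hg : IsConcentrated E B δ v) (hE : IsStarForest E) (he : e ∈ E) :
    |generator (fun v => share E v e) v| ≤ rateError E B * (1 / starMass E v e ^ 2) := by
  have hM : 1 ≤ (Fintype.card S₁ : ℝ) := Nat.one_le_cast.2 (Fintype.card_pos_iff.2 ⟨e.1⟩)
  rw [generator_share he v (hg.starMass_pos he)]
  obtain ⟨h1, h1'⟩ := hg.sum_star_successProb_bounds hE he
  obtain ⟨h2, h2'⟩ := hg.successProb_bounds hE he
  have hc := hg.starMass_pos he
  have hu := hg.pos e
  have huc := le_starMass (fun p => (hg.pos p).le) he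
  have hB := hg.bound_nonneg
  have hb : 2 * B + B ^ 2 ≤ rateError E B := by
    refine le_mul_of_one_le_left (by positivity) (Nat.one_le_cast.2 (Finset.card_pos.2 ⟨e, he⟩))
  have hb0 := hg.rateError_nonneg
  generalize ∑ p ∈ star E e, successProb v p = P at *
  generalize successProb v e = s at *
  generalize starMass E v e = c at *
  generalize v e = u at *
  generalize rateError E B = b at *
  generalize (Fintype.card S₁ : ℝ) = M at *
  have hMP : 1 - b / c ≤ M * P ∧ M * P ≤ 1 := by
    constructor
    · rw [sub_le_iff_le_add, ← sub_le_iff_le_add', le_div_iff₀ hc]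
      linarith
    · exact le_of_mul_le_mul_left (by linarith) hc
  have hub : u * (b / c) ≤ b := by
    rw [mul_div_assoc', div_le_iff₀ hc]
    nlinarith
  -- Both `M * s * c` and `M * u * P` equal `u` up to `b` from below, so the leading terms cancel.
  have hnum : |M * (s * c - u * P)| ≤ b := by
    rw [abs_le]
    constructor
    · nlinarith [mul_le_mul_of_nonneg_left hMP.2 hu.le]
    · nlinarith [mul_le_mul_of_nonneg_left hMP.1 hu.le]
  have hnum' : |s * c - u * P| ≤ b := by
    rw [abs_mul, abs_of_pos (one_pos.trans_le hM)] at hnum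
    exact (le_mul_of_one_le_left (abs_nonneg _) hM).trans hnum
  rw [abs_div, abs_of_pos (by positivity : 0 < c * (c + 1)), mul_one_div]
  exact div_le_div₀ hb0 hnum' (by positivity) (by nlinarith)

lemma generator_share_sub_sq_le (hg : IsConcentrated E B δ v) (hE : IsStarForest E) (he : e ∈ E)
    {a : ℝ} (ha : a ∈ Set.Icc (0 : ℝ) 1) :
    generator (fun v => (share E v e - a) ^ 2) v ≤
      (2 * rateError E B + 1) * (1 / starMass E v e ^ 2) := by
  have : Nonempty S₁ := ⟨e.1⟩
  have hc := hg.starMass_pos he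
  have hu := hg.pos e
  have huc := le_starMass (fun p => (hg.pos p).le) he
  -- One reinforcement moves a share by at most `1 / c`, so the quadratic variation is of order `1 /
  -- c ^ 2`, like the drift.
  have hd : ∀ p, |share E (v + Pi.single p 1) e - share E v e| ≤ 1 / starMass E v e := by
    intro p
    simp only [share, starMass_add_single, Pi.add_apply, Pi.single_apply]
    by_cases h : e = p
    · subst h
      simp only [if_pos (self_mem_star he), if_true]
      have : (v e + 1) / (starMass E v e + 1) - v e / starMass E v e =
          (starMass E v e - v e) / (starMass E v e * (starMass E v e + 1)) := by
        field_simp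
        ring
      rw [this, abs_of_nonneg (div_nonneg (sub_nonneg.2 huc) (by positivity)),
        div_le_div_iff₀ (by positivity) hc]
      nlinarith
    · simp only [if_neg h, add_zero]
      split_ifs
      · have : v e / (starMass E v e + 1) - v e / starMass E v e =
            -(v e / (starMass E v e * (starMass E v e + 1))) := by
          field_simp
          ring
        rw [this, abs_neg, abs_of_nonneg (by positivity), div_le_div_iff₀ (by positivity) hc]
        nlinarith
      · rw [add_zero, sub_self, abs_zero]
        positivity
  have h1 := generator_sq_le hg.pos (fun v => share E v e) a hd
  have h2 := hg.abs_generator_share_le hE he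
  have h3 := hg.share_mem_Icc he
  have h4 : |share E v e - a| ≤ 1 := by
    rw [abs_le]
    constructor <;> linarith [h3.1, h3.2, ha.1, ha.2]
  have h5 : (share E v e - a) * generator (fun v => share E v e) v ≤
      1 * (rateError E B * (1 / starMass E v e ^ 2)) := by
    refine (le_abs_self _).trans ?_
    rw [abs_mul]
    exact mul_le_mul h4 h2 (abs_nonneg _) zero_le_one
  have h6 : (1 / starMass E v e) ^ 2 = 1 / starMass E v e ^ 2 := by rw [div_pow, one_pow]
  rw [h6] at h1
  linarith

end IsConcentrated

/-- The normalised difference of the payoffs of two stars. -/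
def imbalance (E : Finset (S₁ × S₂)) (v : S₁ × S₂ → ℝ) (e e' : S₁ × S₂) : ℝ :=
  (starMass E v e - starMass E v e') / (starMass E v e + starMass E v e')

/-! ### Drift of the imbalance of two stars -/

namespace IsConcentrated

lemma imbalance_mem_Icc (hg : IsConcentrated E B δ v) (he : e ∈ E) (he' : e' ∈ E) :
    imbalance E v e e' ∈ Set.Icc (-1) 1 := by
  have hc := hg.starMass_pos he
  have hc' := hg.starMass_pos he'
  have ht : 0 < starMass E v e + starMass E v e' := by positivity
  constructor
  · rw [imbalance, le_div_iff₀ ht]; linarith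
  · rw [imbalance, div_le_iff₀ ht]; linarith

/-- Two stars fed at almost equal rates keep the expected difference of their masses almost constant
while the sum grows, so the normalised difference contracts. The contraction is of order `1 / (c +
c')`, whereas the errors are of order `1 / c ^ 2 + 1 / c' ^ 2`. -/
lemma generator_imbalance_sq_le (hg : IsConcentrated E B δ v) (hE : IsStarForest E) (he : e ∈ E)
    (he' : e' ∈ E) :
    generator (fun v => imbalance E v e e' ^ 2) v ≤
      (4 * rateError E B + 4) * (1 / starMass E v e ^ 2 + 1 / starMass E v e' ^ 2) -
        4 / Fintype.card S₁ *
          (imbalance E v e e' ^ 2 / (starMass E v e + starMass E v e' + 1)) := by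
  have : Nonempty S₁ := ⟨e.1⟩
  have hc := hg.starMass_pos he
  have hc' := hg.starMass_pos he'
  have hb0 := hg.rateError_nonneg
  by_cases hmem : e' ∈ star E e
  · have h0 : ∀ v, imbalance E v e e' = 0 := fun v => by
      rw [imbalance, hE.starMass_eq he hmem, sub_self, zero_div]
    simp only [h0]
    simp only [generator]
    norm_num
    positivity
  have hM : 1 ≤ (Fintype.card S₁ : ℝ) := Nat.one_le_cast.2 (Fintype.card_pos_iff.2 ⟨e.1⟩)
  have hdisj := hE.disjoint_star he he' hmem
  have hd : ∀ p, |imbalance E (v + Pi.single p 1) e e' - imbalance E v e e'| ≤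
      2 / (starMass E v e + starMass E v e') := by
    intro p
    simp only [imbalance, starMass_add_single]
    generalize starMass E v e = c at *
    generalize starMass E v e' = c' at *
    by_cases h1 : p ∈ star E e
    · rw [if_pos h1, if_neg (Finset.disjoint_left.1 hdisj h1)]
      have : (c + 1 - (c' + 0)) / (c + 1 + (c' + 0)) - (c - c') / (c + c') =
          2 * c' / ((c + c') * (c + c' + 1)) := by
        field_simp
        ring
      rw [this, abs_of_nonneg (by positivity), div_le_div_iff₀ (by positivity) (by positivity)]
      nlinarith [mul_pos hc hc', mul_pos hc hc, mul_pos hc' hc']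
    · rw [if_neg h1]
      split_ifs with h2
      · have : (c + 0 - (c' + 1)) / (c + 0 + (c' + 1)) - (c - c') / (c + c') =
            -(2 * c / ((c + c') * (c + c' + 1))) := by
          field_simp
          ring
        rw [this, abs_neg, abs_of_nonneg (by positivity),
          div_le_div_iff₀ (by positivity) (by positivity)]
        nlinarith [mul_pos hc hc', mul_pos hc hc, mul_pos hc' hc']
      · rw [add_zero, add_zero, sub_self, abs_zero]
        positivity
  have h1 := generator_sq_le hg.pos (fun v => imbalance E v e e') 0 hd
  simp only [sub_zero] at h1
  have hr := hg.imbalance_mem_Icc he he'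
  have hgen := generator_comp_starMass_starMass hE he he' hmem
    (fun c c' => (c - c') / (c + c')) v
  obtain ⟨h2, h2'⟩ := hg.sum_star_successProb_bounds hE he
  obtain ⟨h3, h3'⟩ := hg.sum_star_successProb_bounds hE he'
  change generator (fun v => imbalance E v e e') v = _ at hgen
  rw [hgen] at h1
  refine h1.trans ?_
  clear h1 hgen hd hdisj
  have hrdef : imbalance E v e e' * (starMass E v e + starMass E v e') =
      starMass E v e - starMass E v e' := by
    rw [imbalance]
    field_simp
  generalize imbalance E v e e' = r at *
  generalize ∑ p ∈ star E e, successProb v p = P at *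
  generalize ∑ p ∈ star E e', successProb v p = P' at *
  generalize starMass E v e = c at *
  generalize starMass E v e' = c' at *
  generalize rateError E B = b at *
  generalize (Fintype.card S₁ : ℝ) = M at *
  have hM0 : 0 < M := one_pos.trans_le hM
  -- `α` is the relative deficit of the rate of a star; the rate bounds become `0 ≤ α` and `α * c ≤
  -- b`.
  obtain ⟨α, hα⟩ : ∃ α, P = (1 - α) / M := ⟨1 - M * P, by field_simp; ring⟩
  obtain ⟨α', hα'⟩ : ∃ α', P' = (1 - α') / M := ⟨1 - M * P', by field_simp; ring⟩
  have hMP : M * c * P = c - α * c := by rw [hα]; field_simp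
  have hMP' : M * c' * P' = c' - α' * c' := by rw [hα']; field_simp
  rw [hMP] at h2 h2'
  rw [hMP'] at h3 h3'
  have e1 : P * ((c + 1 - c') / (c + 1 + c') - (c - c') / (c + c')) +
      P' * ((c - (c' + 1)) / (c + (c' + 1)) - (c - c') / (c + c')) =
      2 / M * ((-(r * (c + c')) + (α' * c - α * c')) / ((c + c') * (c + c' + 1))) := by
    rw [hrdef, hα, hα']
    field_simp
    ring
  rw [e1]
  have hα0 : 0 ≤ α := nonneg_of_mul_nonneg_left (by linarith) hc
  have hα0' : 0 ≤ α' := nonneg_of_mul_nonneg_left (by linarith) hc'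
  have ht : 0 < c + c' := by positivity
  have e2 : 2 * r * (2 / M * ((-(r * (c + c')) + (α' * c - α * c')) /
      ((c + c') * (c + c' + 1)))) = 4 / M * ((r * (α' * c - α * c')) /
      ((c + c') * (c + c' + 1))) - 4 / M * (r ^ 2 / (c + c' + 1)) := by
    field_simp
    ring
  rw [e2]
  have i1 : r * (α' * c - α * c') ≤ α' * c + α * c' := by
    have p1 : 0 ≤ α' * c := by positivity
    have p2 : 0 ≤ α * c' := by positivity
    nlinarith [mul_le_mul_of_nonneg_right hr.2 p1, mul_le_mul_of_nonneg_right hr.1 p2]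
  have i2 : r * (α' * c - α * c') / ((c + c') * (c + c' + 1)) ≤ b * (1 / c ^ 2 + 1 / c' ^ 2) := by
    have q1 : α * c' / ((c + c') * (c + c' + 1)) ≤ b * (1 / c ^ 2) := by
      rw [mul_one_div, div_le_div_iff₀ (by positivity) (by positivity)]
      calc α * c' * c ^ 2 = (α * c) * (c * c') := by ring
        _ ≤ b * ((c + c') * (c + c' + 1)) := by
          refine mul_le_mul (by linarith) ?_ (by positivity) hb0
          nlinarith [mul_pos hc hc', mul_pos hc hc, mul_pos hc' hc']
    have q2 : α' * c / ((c + c') * (c + c' + 1)) ≤ b * (1 / c' ^ 2) := by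
      rw [mul_one_div, div_le_div_iff₀ (by positivity) (by positivity)]
      calc α' * c * c' ^ 2 = (α' * c') * (c * c') := by ring
        _ ≤ b * ((c + c') * (c + c' + 1)) := by
          refine mul_le_mul (by linarith) ?_ (by positivity) hb0
          nlinarith [mul_pos hc hc', mul_pos hc hc, mul_pos hc' hc']
    have q3 : r * (α' * c - α * c') / ((c + c') * (c + c' + 1)) ≤
        (α' * c + α * c') / ((c + c') * (c + c' + 1)) := by gcongr
    rw [add_div] at q3
    linarith
  have i3 : (2 / (c + c')) ^ 2 ≤ 4 * (1 / c ^ 2 + 1 / c' ^ 2) := by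
    have : (2 / (c + c')) ^ 2 ≤ 4 * (1 / c ^ 2) := by
      rw [div_pow, mul_one_div, div_le_div_iff₀ (by positivity) (by positivity)]
      nlinarith [mul_pos hc hc', mul_pos hc hc, mul_pos hc' hc']
    have : 0 ≤ 1 / c' ^ 2 := by positivity
    linarith
  have i4 : 4 / M * (r * (α' * c - α * c') / ((c + c') * (c + c' + 1))) ≤
      4 * (b * (1 / c ^ 2 + 1 / c' ^ 2)) := by
    refine (mul_le_mul_of_nonneg_left i2 (by positivity)).trans ?_
    refine mul_le_mul_of_nonneg_right ?_ (by positivity)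
    exact div_le_self (by norm_num) hM
  linarith

end IsConcentrated

/-- The sum of the inverse squares of the payoffs of the stars. -/
def invSqSum (E : Finset (S₁ × S₂)) (v : S₁ × S₂ → ℝ) : ℝ := ∑ e ∈ E, 1 / starMass E v e ^ 2

lemma invSqSum_nonneg (E : Finset (S₁ × S₂)) (v : S₁ × S₂ → ℝ) : 0 ≤ invSqSum E v :=
  Finset.sum_nonneg fun _ _ => by positivity

lemma inv_sq_le_invSqSum (he : e ∈ E) (v : S₁ × S₂ → ℝ) :
    1 / starMass E v e ^ 2 ≤ invSqSum E v :=
  Finset.single_le_sum (f := fun e => 1 / starMass E v e ^ 2) (fun _ _ => by positivity) he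

namespace IsConcentrated

/-- The pair keeps a payoff at most `B`, while its two vertices lie on edges of `E` carrying at
least a fraction `δ` of their stars. The rate is thus of order `1 / (c c')`, bounded through the
inverse squares. -/
lemma successProb_le_of_notMem (hg : IsConcentrated E B δ v) (hE : IsStarForest E) (hδ : 0 < δ)
    {p : S₁ × S₂} (hp : p ∉ E) :
    successProb v p ≤ B ^ 2 / δ ^ 2 * 2 * invSqSum E v := by
  have hM : 1 ≤ (Fintype.card S₁ : ℝ) := Nat.one_le_cast.2 (Fintype.card_pos_iff.2 ⟨p.1⟩)
  obtain ⟨e, he, hep⟩ := hE.state p.1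
  obtain ⟨e', he', hep'⟩ := hE.signal p.2
  have hc := hg.starMass_pos he
  have hc' := hg.starMass_pos he'
  have hvp := hg.pos p
  have hpB : v p ≤ B :=
    (Finset.single_le_sum (fun r _ => (hg.pos r).le) (Finset.mem_compl.2 hp)).trans hg.off_le
  have h1 : δ * starMass E v e ≤ stateMass v p.1 := by
    have h1 := hg.le_share e he
    rw [share, le_div_iff₀ hc] at h1
    refine h1.trans ?_
    rw [stateMass_eq_sum_filter]
    exact Finset.single_le_sum (f := v) (fun r _ => (hg.pos r).le) (by simp [hep])
  have h2 : δ * starMass E v e' ≤ signalMass v p.2 := by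
    have h1 := hg.le_share e' he'
    rw [share, le_div_iff₀ hc'] at h1
    refine h1.trans ?_
    rw [signalMass_eq_sum_filter]
    exact Finset.single_le_sum (f := v) (fun r _ => (hg.pos r).le) (by simp [hep'])
  have h3 := inv_sq_le_invSqSum he v
  have h4 := inv_sq_le_invSqSum he' v
  rw [successProb_eq]
  generalize starMass E v e = c at *
  generalize starMass E v e' = c' at *
  have h5 : 1 / (c * c') ≤ 1 / c ^ 2 + 1 / c' ^ 2 := by
    have : 1 / c ^ 2 + 1 / c' ^ 2 - 1 / (c * c') =
        (1 / c - 1 / c') ^ 2 + 1 / (c * c') := by field_simp; ring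
    have : 0 ≤ (1 / c - 1 / c') ^ 2 + 1 / (c * c') := by positivity
    linarith
  calc v p ^ 2 / (Fintype.card S₁ * (stateMass v p.1 * signalMass v p.2))
      ≤ B ^ 2 / (1 * ((δ * c) * (δ * c'))) := by
        gcongr
        exact le_trans (by positivity) h1
    _ = B ^ 2 / δ ^ 2 * (1 / (c * c')) := by field_simp
    _ ≤ B ^ 2 / δ ^ 2 * (2 * invSqSum E v) := by gcongr; linarith
    _ = _ := by ring

end IsConcentrated

end Drift

/-! ### Confinement near a star forest -/

section Confinement

variable [DecidableEq S₁] [DecidableEq S₂]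

/-- A Lyapunov function measuring the distance of the payoffs from the star forest `E` with
prescribed shares `a`. -/
def forestLyapunov (E : Finset (S₁ × S₂)) (V₀ a : S₁ × S₂ → ℝ) (δ K : ℝ) (v : S₁ × S₂ → ℝ) : ℝ :=
  ∑ p ∈ Eᶜ, (v p - V₀ p) + 1 / δ ^ 2 * ∑ e ∈ E, (share E v e - a e) ^ 2 +
    K * ∑ e ∈ E, 1 / starMass E v e

variable {E : Finset (S₁ × S₂)} {e e' : S₁ × S₂} {V₀ a v : S₁ × S₂ → ℝ} {δ K : ℝ}

lemma starMass_nonneg (hv : ∀ p, 0 ≤ v p) : 0 ≤ starMass E v e := Finset.sum_nonneg fun p _ => hv p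

lemma share_nonneg (hv : ∀ p, 0 ≤ v p) : 0 ≤ share E v e := div_nonneg (hv e) (starMass_nonneg hv)

lemma forestLyapunov_terms (hV₀ : ∀ p, 0 < V₀ p) (hv : V₀ ≤ v) (hK : 0 ≤ K) {L : ℝ}
    (h : forestLyapunov E V₀ a δ K v < L) :
    ∑ p ∈ Eᶜ, (v p - V₀ p) < L ∧ 1 / δ ^ 2 * ∑ e ∈ E, (share E v e - a e) ^ 2 < L ∧
      K * ∑ e ∈ E, 1 / starMass E v e < L := by
  have h1 : 0 ≤ ∑ p ∈ Eᶜ, (v p - V₀ p) := Finset.sum_nonneg fun p _ => sub_nonneg.2 (hv p)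
  have h2 : 0 ≤ 1 / δ ^ 2 * ∑ e ∈ E, (share E v e - a e) ^ 2 := by positivity
  have h3 : 0 ≤ K * ∑ e ∈ E, 1 / starMass E v e :=
    mul_nonneg hK (Finset.sum_nonneg fun e _ => one_div_nonneg.2
      (starMass_nonneg fun p => (hV₀ p).le.trans (hv p)))
  unfold forestLyapunov at h
  refine ⟨?_, ?_, ?_⟩ <;> linarith

lemma forestLyapunov_nonneg (hV₀ : ∀ p, 0 < V₀ p) (hv : V₀ ≤ v) (hK : 0 ≤ K) :
    0 ≤ forestLyapunov E V₀ a δ K v := by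
  by_contra h
  have h1 := (forestLyapunov_terms hV₀ hv hK (not_le.1 h)).1
  exact h1.not_ge (Finset.sum_nonneg fun p _ => sub_nonneg.2 (hv p))

lemma abs_share_sub_lt (hV₀ : ∀ p, 0 < V₀ p) (hv : V₀ ≤ v) (hK : 0 ≤ K) (hδ : 0 < δ)
    (h : forestLyapunov E V₀ a δ K v < 1) (he : e ∈ E) : |share E v e - a e| < δ := by
  have h1 := (forestLyapunov_terms hV₀ hv hK h).2.1
  rw [one_div_mul_eq_div, div_lt_one (by positivity)] at h1
  refine abs_lt_of_sq_lt_sq (lt_of_le_of_lt ?_ h1) hδ.le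
  exact Finset.single_le_sum (f := fun e => (share E v e - a e) ^ 2) (fun _ _ => sq_nonneg _) he

/-- Each of the three nonnegative terms is below `1`: the first bounds the payoffs outside `E`, the
second keeps the shares within `δ` of `a ≥ 2 * δ`, and the third makes every star mass at least `K`.
-/
lemma isConcentrated_of_forestLyapunov_lt (hV₀ : ∀ p, 0 < V₀ p) (hv : V₀ ≤ v) (hK : 1 ≤ K)
    (hδ : 0 < δ) (ha : ∀ e ∈ E, 2 * δ ≤ a e)
    (hK' : 2 * rateError E (∑ p ∈ Eᶜ, V₀ p + 1) ≤ K)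
    (h : forestLyapunov E V₀ a δ K v < 1) :
    IsConcentrated E (∑ p ∈ Eᶜ, V₀ p + 1) δ v := by
  have hK0 : 0 ≤ K := zero_le_one.trans hK
  have hv0 : ∀ p, 0 < v p := fun p => (hV₀ p).trans_le (hv p)
  obtain ⟨h1, -, h3⟩ := forestLyapunov_terms hV₀ hv hK0 h
  have hC : ∀ e ∈ E, K ≤ starMass E v e := fun e he => by
    have hc : 0 < starMass E v e := Finset.sum_pos (fun p _ => hv0 p) ⟨e, self_mem_star he⟩
    have h4 : 1 / starMass E v e ≤ ∑ e ∈ E, 1 / starMass E v e :=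
      Finset.single_le_sum (f := fun e => 1 / starMass E v e)
        (fun e _ => one_div_nonneg.2 (starMass_nonneg fun p => (hv0 p).le)) he
    have h5 := (mul_le_mul_of_nonneg_left h4 hK0).trans h3.le
    rw [mul_one_div, div_le_one hc] at h5
    exact h5
  refine ⟨hv0, ?_, fun e he => hK.trans (hC e he), fun e he => hK'.trans (hC e he),
    fun e he => ?_⟩
  · rw [Finset.sum_sub_distrib] at h1
    linarith
  · have := (abs_lt.1 (abs_share_sub_lt hV₀ hv hK0 hδ h he)).1
    linarith [ha e he]

lemma IsConcentrated.generator_forestLyapunov_le {B : ℝ} (hg : IsConcentrated E B δ v)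
    (hE : IsStarForest E) (hδ : 0 < δ) (hK : 0 ≤ K) (ha : ∀ e ∈ E, a e ∈ Set.Icc (0 : ℝ) 1) :
    generator (forestLyapunov E V₀ a δ K) v ≤
      ((Eᶜ.card : ℝ) * (B ^ 2 / δ ^ 2 * 2) + 1 / δ ^ 2 * (2 * rateError E B + 1) -
        K * (1 / (4 * Fintype.card S₁))) * invSqSum E v := by
  unfold forestLyapunov
  rw [generator_add, generator_add, generator_const_mul, generator_const_mul, generator_sum,
    generator_sum, generator_sum]
  have h1 : ∑ p ∈ Eᶜ, generator (fun v => v p - V₀ p) v ≤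
      (Eᶜ.card : ℝ) * (B ^ 2 / δ ^ 2 * 2) * invSqSum E v := by
    rw [mul_assoc, ← nsmul_eq_mul]
    refine Finset.sum_le_card_nsmul _ _ _ fun p hp => ?_
    rw [generator_apply_sub]
    exact hg.successProb_le_of_notMem hE hδ (Finset.mem_compl.1 hp)
  have h2 : ∑ e ∈ E, generator (fun v => (share E v e - a e) ^ 2) v ≤
      (2 * rateError E B + 1) * invSqSum E v := by
    rw [invSqSum, Finset.mul_sum]
    exact Finset.sum_le_sum fun e he => hg.generator_share_sub_sq_le hE he (ha e he)
  have h3 : ∑ e ∈ E, generator (fun v => 1 / starMass E v e) v ≤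
      -(1 / (4 * Fintype.card S₁) * invSqSum E v) := by
    rw [invSqSum, Finset.mul_sum, ← Finset.sum_neg_distrib]
    exact Finset.sum_le_sum fun e he => hg.generator_inv_starMass_le hE he
  have h2' := mul_le_mul_of_nonneg_left h2 (by positivity : 0 ≤ 1 / δ ^ 2)
  have h3' := mul_le_mul_of_nonneg_left h3 hK
  linarith

/-- For a suitable constant, `forestLyapunov` is a Lyapunov function that dominates small
perturbations. -/
lemma exists_isLyapunov_forestLyapunov [Nonempty S₁] (hE : IsStarForest E) (hV₀ : ∀ p, 0 < V₀ p)
    (hδ : 0 < δ) (ha : ∀ e ∈ E, 2 * δ ≤ a e ∧ a e ≤ 1) :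
    ∃ K : ℝ, 0 ≤ K ∧
      (∀ v, V₀ ≤ v → forestLyapunov E V₀ a δ K v < 1 →
        IsConcentrated E (∑ p ∈ Eᶜ, V₀ p + 1) δ v) ∧
      IsLyapunov V₀ (forestLyapunov E V₀ a δ K) (invSqSum E) ∧
      ∀ (ψ D : (S₁ × S₂ → ℝ) → ℝ) (L : ℝ), 0 ≤ L → (∀ v, V₀ ≤ v → 0 ≤ ψ v) →
        (∀ v, V₀ ≤ v → 0 ≤ D v) →
        (∀ v, IsConcentrated E (∑ p ∈ Eᶜ, V₀ p + 1) δ v →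
          generator ψ v ≤ L * invSqSum E v - D v) →
        IsLyapunov V₀ (fun v => forestLyapunov E V₀ a δ K v + 1 / (2 * (1 + L)) * ψ v)
          (fun v => 1 / (2 * (1 + L)) * D v) := by
  have hM : 0 < (Fintype.card S₁ : ℝ) := Nat.cast_pos.2 Fintype.card_pos
  set B : ℝ := ∑ p ∈ Eᶜ, V₀ p + 1 with hBdef
  have hB : 0 ≤ B := add_nonneg (Finset.sum_nonneg fun p _ => (hV₀ p).le) zero_le_one
  have hb : 0 ≤ rateError E B := by unfold rateError; positivity
  set κ : ℝ := (Eᶜ.card : ℝ) * (B ^ 2 / δ ^ 2 * 2) + 1 / δ ^ 2 * (2 * rateError E B + 1) with hκ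
  have hκ0 : 0 ≤ κ := by positivity
  -- `κ` collects the harmful drifts. The first summand of `K` makes the drift of the inverse masses
  -- beat `κ` with `1` to spare; the other two provide the bounds on `K` needed for concentration.
  set K : ℝ := 4 * Fintype.card S₁ * (κ + 1) + 1 + 2 * rateError E B with hKdef
  have hK1 : 1 ≤ K := by
    have : 0 ≤ 4 * (Fintype.card S₁ : ℝ) * (κ + 1) := by positivity
    linarith
  have hK0 : 0 ≤ K := zero_le_one.trans hK1
  have hK2 : 2 * rateError E B ≤ K := by
    have : 0 ≤ 4 * (Fintype.card S₁ : ℝ) * (κ + 1) := by positivity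
    linarith
  have hK3 : κ + 1 ≤ K * (1 / (4 * Fintype.card S₁)) := by
    rw [mul_one_div, le_div_iff₀ (by positivity)]
    linarith
  have hconc : ∀ v, V₀ ≤ v → forestLyapunov E V₀ a δ K v < 1 → IsConcentrated E B δ v :=
    fun v hv h => isConcentrated_of_forestLyapunov_lt hV₀ hv hK1 hδ (fun e he => (ha e he).1) hK2 h
  have hgen : ∀ v, V₀ ≤ v → forestLyapunov E V₀ a δ K v < 1 →
      generator (forestLyapunov E V₀ a δ K) v ≤ -invSqSum E v := by
    intro v hv h
    refine ((hconc v hv h).generator_forestLyapunov_le hE hδ hK0 fun e he =>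
      ⟨by linarith [(ha e he).1], (ha e he).2⟩).trans ?_
    have := mul_le_mul_of_nonneg_right hK3 (invSqSum_nonneg E v)
    linarith
  refine ⟨K, hK0, hconc, ⟨fun v hv => forestLyapunov_nonneg hV₀ hv hK0,
    fun v _ _ => invSqSum_nonneg E v, hgen⟩, fun ψ D L hL hψ hD hψD => ?_⟩
  -- With this factor the error `L * invSqSum E v` is absorbed by the spare drift of
  -- `forestLyapunov`. The factor is also at most `1/2`, so the perturbed function stays below `1`
  -- when the original is below `1/2` and `ψ ≤ 1`.
  have hε : 0 < 1 / (2 * (1 + L)) := by positivity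
  refine ⟨fun v hv => add_nonneg (forestLyapunov_nonneg hV₀ hv hK0) (mul_nonneg hε.le (hψ v hv)),
    fun v hv _ => mul_nonneg hε.le (hD v hv), fun v hv h => ?_⟩
  have hlt : forestLyapunov E V₀ a δ K v < 1 := by
    have := mul_nonneg hε.le (hψ v hv)
    linarith
  rw [generator_add, generator_const_mul]
  have h1 := hgen v hv hlt
  have h2 := mul_le_mul_of_nonneg_left (hψD v (hconc v hv hlt)) hε.le
  have h3 : 1 / (2 * (1 + L)) * L ≤ 1 := by
    rw [one_div_mul_eq_div, div_le_one (by positivity)]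
    linarith
  have h4 := mul_le_mul_of_nonneg_right h3 (invSqSum_nonneg E v)
  linarith

/-! ### Almost sure limits on the event of confinement -/

lemma eq_zero_of_summable_div {u t : ℕ → ℝ} {l c : ℝ} (hu : Tendsto u atTop (𝓝 l))
    (hu0 : ∀ n, 0 ≤ u n) (ht0 : ∀ᶠ n in atTop, 0 < t n) (ht : ∀ n, t n ≤ c * (n + 1))
    (hs : Summable fun n => u n / t n) : l = 0 := by
  have hl : 0 ≤ l := ge_of_tendsto' hu hu0
  by_contra hne
  have hl' : 0 < l := lt_of_le_of_ne hl (Ne.symm hne)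
  -- Were `l` positive, eventually `u n ≥ l / 2`, and linear growth of `t` would make the harmonic
  -- series converge.
  have hev : ∀ᶠ n : ℕ in atTop, ‖1 / ((n : ℝ) + 1)‖ ≤ c * (2 / l) * (u n / t n) := by
    filter_upwards [ht0, hu.eventually (lt_mem_nhds (half_lt_self hl'))] with n h1 h2
    have hn : 0 < (n : ℝ) + 1 := by positivity
    have hc : 0 < c := pos_of_mul_pos_left (h1.trans_le (ht n)) hn.le
    rw [Real.norm_of_nonneg (by positivity), mul_div_assoc', div_le_div_iff₀ hn h1]
    have h3 : 1 ≤ 2 / l * u n := by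
      rw [div_mul_eq_mul_div, le_div_iff₀ hl']
      linarith
    calc 1 * t n ≤ c * (n + 1) * 1 := by linarith [ht n]
      _ ≤ c * (n + 1) * (2 / l * u n) := by gcongr
      _ = c * (2 / l) * u n * (n + 1) := by ring
  have hsum := Summable.of_norm_bounded_eventually_nat (hs.mul_left (c * (2 / l))) hev
  have := (summable_nat_add_iff (f := fun n : ℕ => 1 / (n : ℝ)) 1).1 (by simpa using hsum)
  exact Real.not_summable_one_div_natCast this

variable {S : ℕ → Ω → S₁} {Y : ℕ → Ω → S₂} {Z : ℕ → Ω → S₁}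
  {mΩ : MeasurableSpace Ω} {μ : Measure Ω} {ℱ : Filtration ℕ mΩ}

lemma starMass_payoff_le (hV₀ : ∀ p, 0 < V₀ p) (n : ℕ) (ω : Ω) (e : S₁ × S₂) :
    starMass E (payoff V₀ S Y Z n ω) e ≤
      (∑ p, V₀ p + Fintype.card (S₁ × S₂)) * ((n : ℝ) + 1) := by
  have h1 : starMass E (payoff V₀ S Y Z n ω) e ≤ ∑ p, payoff V₀ S Y Z n ω p :=
    Finset.sum_le_sum_of_subset_of_nonneg (Finset.subset_univ _)
      fun p _ _ => (hV₀ p).le.trans (le_payoff n ω p)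
  have h2 : ∑ p, payoff V₀ S Y Z n ω p ≤ ∑ p, (V₀ p + n) :=
    Finset.sum_le_sum fun p _ => payoff_le n ω p
  have h3 : 0 ≤ ∑ p, V₀ p := Finset.sum_nonneg fun p _ => (hV₀ p).le
  rw [Finset.sum_add_distrib, Finset.sum_const, nsmul_eq_mul, Finset.card_univ] at h2
  have hc : (0 : ℝ) ≤ Fintype.card (S₁ × S₂) := Nat.cast_nonneg _
  have hn : (0 : ℝ) ≤ n := Nat.cast_nonneg _
  nlinarith [mul_nonneg h3 hn]

/-- Where both truncations are inactive, the perturbation is recovered as a difference of two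
convergent sequences. -/
lemma tendsto_of_min_tendsto {f g : ℕ → ℝ} {ε l l' : ℝ} (hε : 0 < ε)
    (hf : ∀ᶠ n in atTop, f n < 1) (hfg : ∀ᶠ n in atTop, f n + ε * g n < 1)
    (h1 : Tendsto (fun n => min (f n) 1) atTop (𝓝 l))
    (h2 : Tendsto (fun n => min (f n + ε * g n) 1) atTop (𝓝 l')) :
    Tendsto g atTop (𝓝 ((l' - l) / ε)) := by
  refine ((h2.sub h1).div_const ε).congr' ?_
  filter_upwards [hf, hfg] with n h3 h4
  rw [min_eq_left h3.le, min_eq_left h4.le, add_sub_cancel_left, mul_div_cancel_left₀ _ (ne_of_gt hε)]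

/-- The payoffs have the asymptotics of a collection of urns, one for each star of `E`. -/
structure HasForestLimit (E : Finset (S₁ × S₂)) (w : ℕ → S₁ × S₂ → ℝ) : Prop where
  share : ∀ e ∈ E, ∃ l, Tendsto (fun n => share E (w n) e) atTop (𝓝 l)
  starMass : ∀ e ∈ E, Tendsto (fun n => starMass E (w n) e) atTop atTop
  imbalance : ∀ e ∈ E, ∀ e' ∈ E, Tendsto (fun n => imbalance E (w n) e e') atTop (𝓝 0)

/-- On the event that a perturbed Lyapunov function stays below `1`, the perturbation converges
and its drift is summable. -/
lemma IsRothErevGame.ae_tendsto_perturbation [IsProbabilityMeasure μ]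
    (h : IsRothErevGame μ ℱ V₀ S Y Z) (hV₀ : ∀ p, 0 < V₀ p) {φ D₀ ψ D : (S₁ × S₂ → ℝ) → ℝ} {ε : ℝ}
    (hε : 0 < ε) (hε' : ε ≤ 1 / 2) (hφ : IsLyapunov V₀ φ D₀)
    (hφψ : IsLyapunov V₀ (fun v => φ v + ε * ψ v) (fun v => ε * D v))
    (hψ : ∀ v, V₀ ≤ v → φ v < 1 → ψ v ≤ 1) :
    ∀ᵐ ω ∂μ, (∀ᶠ n in atTop, φ (payoff V₀ S Y Z n ω) < 1 / 2) →
      (∃ l, Tendsto (fun n => ψ (payoff V₀ S Y Z n ω)) atTop (𝓝 l)) ∧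
        Summable fun n => D (payoff V₀ S Y Z n ω) := by
  filter_upwards [h.ae_tendsto_min hV₀ hφ, h.ae_tendsto_min hV₀ hφψ,
    h.ae_summable_drift hV₀ hφψ] with ω h1 h2 h3 hev
  obtain ⟨l, hl⟩ := h1
  obtain ⟨l', hl'⟩ := h2
  have hev1 : ∀ᶠ n in atTop, φ (payoff V₀ S Y Z n ω) < 1 := hev.mono fun n hn => by linarith
  have hev2 : ∀ᶠ n in atTop,
      φ (payoff V₀ S Y Z n ω) + ε * ψ (payoff V₀ S Y Z n ω) < 1 := by
    filter_upwards [hev, hev1] with n h4 h5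
    have h6 := mul_le_mul_of_nonneg_left (hψ _ (le_payoff n ω) h5) hε.le
    linarith
  refine ⟨⟨_, tendsto_of_min_tendsto hε hev1 hev2 hl hl'⟩, ?_⟩
  have h4 : Summable fun n => ε * D (payoff V₀ S Y Z n ω) := by
    refine h3.congr_atTop ?_
    filter_upwards [hev2] with n hn
    rw [if_pos hn]
  exact (summable_mul_left_iff hε.ne').1 h4

lemma IsRothErevGame.ae_hasForestLimit [IsProbabilityMeasure μ] [Nonempty S₁]
    (h : IsRothErevGame μ ℱ V₀ S Y Z) (hV₀ : ∀ p, 0 < V₀ p) (hE : IsStarForest E)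
    (hδ : 0 < δ) (ha : ∀ e ∈ E, 2 * δ ≤ a e ∧ a e ≤ 1) :
    ∃ K : ℝ, 0 ≤ K ∧ IsLyapunov V₀ (forestLyapunov E V₀ a δ K) (invSqSum E) ∧
      ∀ᵐ ω ∂μ, (∀ᶠ n in atTop, forestLyapunov E V₀ a δ K (payoff V₀ S Y Z n ω) < 1 / 2) →
        HasForestLimit E fun n => payoff V₀ S Y Z n ω := by
  obtain ⟨K, hK, hconc, hφ, hpert⟩ := exists_isLyapunov_forestLyapunov hE hV₀ hδ ha
  refine ⟨K, hK, hφ, ?_⟩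
  have hv0 : ∀ v, V₀ ≤ v → ∀ p, 0 ≤ v p := fun v hv p => (hV₀ p).le.trans (hv p)
  set B : ℝ := ∑ p ∈ Eᶜ, V₀ p + 1 with hBdef
  have hB : 0 ≤ B := add_nonneg (Finset.sum_nonneg fun p _ => (hV₀ p).le) zero_le_one
  have hb : 0 ≤ rateError E B := by unfold rateError; positivity
  have hεle : ∀ L : ℝ, 0 ≤ L → 0 < 1 / (2 * (1 + L)) ∧ 1 / (2 * (1 + L)) ≤ 1 / 2 := fun L hL =>
    ⟨by positivity, one_div_le_one_div_of_le (by norm_num) (by linarith)⟩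
  -- Perturb by the share itself, with no drift term: its generator is an error of order `invSqSum`.
  have hshare : ∀ e ∈ E, ∀ᵐ ω ∂μ,
      (∀ᶠ n in atTop, forestLyapunov E V₀ a δ K (payoff V₀ S Y Z n ω) < 1 / 2) →
        ∃ l, Tendsto (fun n => share E (payoff V₀ S Y Z n ω) e) atTop (𝓝 l) := fun e he => by
    have hpsi := hpert (fun v => share E v e) (fun _ => 0) (rateError E B) hb
      (fun v hv => share_nonneg (hv0 v hv)) (fun _ _ => le_rfl) fun v hg => by
        rw [sub_zero]
        exact (le_abs_self _).trans ((hg.abs_generator_share_le hE he).trans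
          (mul_le_mul_of_nonneg_left (inv_sq_le_invSqSum he v) hb))
    filter_upwards [h.ae_tendsto_perturbation hV₀ (hεle _ hb).1 (hεle _ hb).2 hφ hpsi
      fun v hv hlt => ((hconc v hv hlt).share_mem_Icc he).2] with ω hω hev
    exact (hω hev).1
  have himb : ∀ e ∈ E, ∀ e' ∈ E, ∀ᵐ ω ∂μ,
      (∀ᶠ n in atTop, forestLyapunov E V₀ a δ K (payoff V₀ S Y Z n ω) < 1 / 2) →
        Tendsto (fun n => imbalance E (payoff V₀ S Y Z n ω) e e') atTop (𝓝 0) := by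
    intro e he e' he'
    have hL : 0 ≤ (4 * rateError E B + 4) * 2 := by positivity
    have hM : 0 < (Fintype.card S₁ : ℝ) := Nat.cast_pos.2 Fintype.card_pos
    have hpsi := hpert (fun v => imbalance E v e e' ^ 2)
      (fun v => 4 / Fintype.card S₁ *
        (imbalance E v e e' ^ 2 / (starMass E v e + starMass E v e' + 1)))
      ((4 * rateError E B + 4) * 2) hL (fun v _ => sq_nonneg _)
      (fun v hv => by
        have h1 := starMass_nonneg (E := E) (e := e) (hv0 v hv)
        have h2 := starMass_nonneg (E := E) (e := e') (hv0 v hv)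
        positivity)
      fun v hg => by
        refine (hg.generator_imbalance_sq_le hE he he').trans (sub_le_sub_right ?_ _)
        rw [mul_assoc]
        refine mul_le_mul_of_nonneg_left ?_ (by positivity)
        linarith [inv_sq_le_invSqSum he v, inv_sq_le_invSqSum he' v]
    filter_upwards [h.ae_tendsto_perturbation hV₀ (hεle _ hL).1 (hεle _ hL).2 hφ hpsi
      fun v hv hlt => by
        have := (hconc v hv hlt).imbalance_mem_Icc he he'
        nlinarith [this.1, this.2]] with ω hω hev
    obtain ⟨⟨l, hl⟩, hsum⟩ := hω hev
    have hsum' := (summable_mul_left_iff (by positivity : 4 / (Fintype.card S₁ : ℝ) ≠ 0)).1 hsum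
    -- The squared imbalance divided by a quantity of at most linear growth is summable, and the
    -- squared imbalance converges.
    have hl0 : l = 0 := by
      refine eq_zero_of_summable_div hl (fun n => sq_nonneg _)
        (Eventually.of_forall fun n => ?_) (fun n => ?_)
        (c := 2 * (∑ p, V₀ p + Fintype.card (S₁ × S₂)) + 1) hsum'
      · have h0 := hv0 _ (le_payoff (S := S) (Y := Y) (Z := Z) n ω)
        have h1 := starMass_nonneg (E := E) (e := e) h0
        have h2 := starMass_nonneg (E := E) (e := e') h0
        positivity
      · have h1 := starMass_payoff_le (E := E) (S := S) (Y := Y) (Z := Z) hV₀ n ω e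
        have h2 := starMass_payoff_le (E := E) (S := S) (Y := Y) (Z := Z) hV₀ n ω e'
        have hn : (0 : ℝ) ≤ n := Nat.cast_nonneg _
        linarith
    rw [hl0] at hl
    have := hl.sqrt
    simp only [Real.sqrt_sq_eq_abs, Real.sqrt_zero] at this
    exact (tendsto_zero_iff_abs_tendsto_zero _).2 this
  have hall := (ae_ball_iff (Finset.countable_toSet E)).2 hshare
  have hall' := (ae_ball_iff (Finset.countable_toSet E)).2 fun e he =>
    (ae_ball_iff (Finset.countable_toSet E)).2 (himb e he)
  filter_upwards [hall, hall', h.ae_summable_drift hV₀ hφ] with ω h1 h2 h3 hev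
  refine ⟨fun e he => h1 e he hev, fun e he => ?_, fun e he e' he' => h2 e he e' he' hev⟩
  -- The drift of the unperturbed Lyapunov function is summable, hence tends to `0`; this forces
  -- each star mass to infinity.
  have h4 : Tendsto (fun n => invSqSum E (payoff V₀ S Y Z n ω)) atTop (𝓝 0) := by
    refine h3.tendsto_atTop_zero.congr' ?_
    filter_upwards [hev] with n hn
    rw [if_pos (by linarith)]
  have hpos : ∀ n, 0 < starMass E (payoff V₀ S Y Z n ω) e := fun n =>
    Finset.sum_pos (fun p _ => (hV₀ p).trans_le (le_payoff n ω p)) ⟨e, self_mem_star he⟩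
  have h5 : Tendsto (fun n => 1 / starMass E (payoff V₀ S Y Z n ω) e ^ 2) atTop (𝓝 0) :=
    squeeze_zero (fun n => by positivity) (fun n => inv_sq_le_invSqSum he _) h4
  have h6 : Tendsto (fun n => (starMass E (payoff V₀ S Y Z n ω) e)⁻¹) atTop (𝓝 0) := by
    have := h5.sqrt
    refine (by simpa using this : Tendsto _ _ _).congr fun n => ?_
    rw [Real.sqrt_sq (hpos n).le]
  have h7 : Tendsto (fun n => (starMass E (payoff V₀ S Y Z n ω) e)⁻¹) atTop (𝓝[>] 0) :=
    tendsto_nhdsWithin_iff.2 ⟨h6, Eventually.of_forall fun n => inv_pos.2 (hpos n)⟩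
  refine h7.inv_tendsto_nhdsGT_zero.congr fun n => ?_
  simp

end Confinement

/-! ### Convergence to equilibria supported on star forests -/

section Convergence

variable [DecidableEq S₁] [DecidableEq S₂]

variable {E : Finset (S₁ × S₂)} {e e' : S₁ × S₂} {V₀ a q : S₁ × S₂ → ℝ} {δ K : ℝ}

/-- The number of stars of the star forest `E`. -/
def starCount (E : Finset (S₁ × S₂)) : ℝ := ∑ e ∈ E, 1 / ((star E e).card : ℝ)

lemma starCount_pos (h : E.Nonempty) : 0 < starCount E :=
  Finset.sum_pos (fun _ he => one_div_pos.2
    (Nat.cast_pos.2 (Finset.card_pos.2 ⟨_, self_mem_star he⟩))) h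

lemma tendsto_starMass_div {w : ℕ → S₁ × S₂ → ℝ} (hw : ∀ n p, 0 < w n p)
    (h : HasForestLimit E w) (he : e ∈ E) (he' : e' ∈ E) :
    Tendsto (fun n => starMass E (w n) e / starMass E (w n) e') atTop (𝓝 1) := by
  have h1 := h.imbalance e he e' he'
  -- If `r` is the imbalance, the ratio of the two masses is `(1 + r) / (1 - r)`.
  have h2 : Tendsto (fun n => (1 + imbalance E (w n) e e') / (1 - imbalance E (w n) e e'))
      atTop (𝓝 ((1 + 0) / (1 - 0))) :=
    (tendsto_const_nhds.add h1).div (tendsto_const_nhds.sub h1) (by norm_num)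
  rw [show ((1 : ℝ) + 0) / (1 - 0) = 1 by norm_num] at h2
  refine h2.congr fun n => ?_
  have hc : 0 < starMass E (w n) e := Finset.sum_pos (fun p _ => hw n p) ⟨e, self_mem_star he⟩
  have hc' : 0 < starMass E (w n) e' := Finset.sum_pos (fun p _ => hw n p) ⟨e', self_mem_star he'⟩
  have e1 : 1 + imbalance E (w n) e e' =
      2 * starMass E (w n) e / (starMass E (w n) e + starMass E (w n) e') := by
    rw [imbalance]; field_simp; ring
  have e2 : 1 - imbalance E (w n) e e' =
      2 * starMass E (w n) e' / (starMass E (w n) e + starMass E (w n) e') := by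
    rw [imbalance]; field_simp; ring
  rw [e1, e2]
  field_simp

/-- The occupation measure converges, with equal masses on all stars. -/
lemma HasForestLimit.tendsto_div_sum {w : ℕ → S₁ × S₂ → ℝ} (hE : IsStarForest E)
    (hne : E.Nonempty) (hw : ∀ n p, 0 < w n p) (h : HasForestLimit E w)
    (hoff : ∀ p ∉ E, ∃ c, ∀ᶠ n in atTop, w n p ≤ c) {l : S₁ × S₂ → ℝ}
    (hl : ∀ e ∈ E, Tendsto (fun n => SignalingGame.share E (w n) e) atTop (𝓝 (l e))) :
    ∑ e ∈ E, l e = starCount E ∧ (∀ e ∈ E, ∑ p ∈ star E e, l p = 1) ∧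
      ∀ p, Tendsto (fun n => w n p / ∑ r, w n r) atTop
        (𝓝 ((if p ∈ E then l p else 0) / starCount E)) := by
  obtain ⟨e₀, he₀⟩ := hne
  have hc : ∀ e ∈ E, ∀ n, 0 < SignalingGame.starMass E (w n) e := fun e he n =>
    Finset.sum_pos (fun p _ => hw n p) ⟨e, self_mem_star he⟩
  have hsum : ∑ e ∈ E, l e = starCount E := by
    refine tendsto_nhds_unique (tendsto_finsetSum E hl) ?_
    refine tendsto_const_nhds.congr fun n => ?_
    exact (hE.sum_share fun p _ => hw n p).symm
  have hstar : ∀ e ∈ E, ∑ p ∈ star E e, l p = 1 := fun e he => by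
    refine tendsto_nhds_unique (tendsto_finsetSum _ fun p hp => hl p (star_subset hp)) ?_
    refine tendsto_const_nhds.congr fun n => ?_
    have : ∀ p ∈ star E e, SignalingGame.share E (w n) p =
        w n p / SignalingGame.starMass E (w n) e := fun p hp => by
      rw [SignalingGame.share, hE.starMass_eq he hp]
    rw [Finset.sum_congr rfl this, ← Finset.sum_div]
    exact (div_self (hc e he n).ne').symm
  -- All payoffs are measured in units of one reference star; the total is then asymptotically the
  -- number of stars.
  have hrel : ∀ p, Tendsto (fun n => w n p / SignalingGame.starMass E (w n) e₀) atTop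
      (𝓝 (if p ∈ E then l p else 0)) := by
    intro p
    split_ifs with hp
    · have := (hl p hp).mul (tendsto_starMass_div hw h hp he₀)
      rw [mul_one] at this
      refine this.congr fun n => ?_
      have := hc p hp n
      rw [SignalingGame.share]
      field_simp
    · obtain ⟨c, hcb⟩ := hoff p hp
      refine squeeze_zero' (Eventually.of_forall fun n =>
        div_nonneg (hw n p).le (hc e₀ he₀ n).le) ?_
        ((h.starMass e₀ he₀).const_div_atTop c)
      filter_upwards [hcb] with n hn
      exact div_le_div_of_nonneg_right hn (hc e₀ he₀ n).le
  have hsum' : Tendsto (fun n => (∑ r, w n r) / SignalingGame.starMass E (w n) e₀) atTop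
      (𝓝 (starCount E)) := by
    have h1 := tendsto_finsetSum Finset.univ fun p _ => hrel p
    simp only [Finset.sum_ite_mem, Finset.univ_inter, hsum] at h1
    exact h1.congr fun n => (Finset.sum_div _ _ _).symm
  refine ⟨hsum, hstar, fun p => ?_⟩
  refine ((hrel p).div hsum' (starCount_pos ⟨e₀, he₀⟩).ne').congr fun n => ?_
  simp only [Pi.div_apply]
  rw [div_div_div_cancel_right₀ (ne_of_gt (hc e₀ he₀ n))]

/-- Starting far out in the direction of `q`, the Lyapunov function is arbitrarily small. -/
lemma tendsto_forestLyapunov_floor (hq : ∀ p, 0 ≤ q p) (hqE : ∀ p, 0 < q p ↔ p ∈ E) :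
    Tendsto (fun m : ℕ => forestLyapunov E V₀ (share E q) δ K
      (V₀ + fun p => ((⌊q p * (m : ℝ)⌋₊ : ℕ) : ℝ))) atTop (𝓝 0) := by
  set v : ℕ → S₁ × S₂ → ℝ := fun m => V₀ + fun p => ((⌊q p * (m : ℝ)⌋₊ : ℕ) : ℝ) with hv
  have h0 : ∀ p ∉ E, q p = 0 := fun p hp =>
    le_antisymm (not_lt.1 fun h => hp ((hqE p).1 h)) (hq p)
  have h1 : ∀ p, Tendsto (fun m : ℕ => v m p / (m : ℝ)) atTop (𝓝 (q p)) := fun p => by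
    have h2 := (tendsto_nat_floor_mul_div_atTop (hq p)).comp
      (tendsto_natCast_atTop_atTop (R := ℝ))
    have h3 := tendsto_const_div_atTop_nhds_zero_nat (V₀ p)
    have := h3.add h2
    rw [zero_add] at this
    refine this.congr fun m => ?_
    simp only [hv, Function.comp, Pi.add_apply]
    rw [add_div]
  have h2 : ∀ e, Tendsto (fun m : ℕ => starMass E (v m) e / (m : ℝ)) atTop
      (𝓝 (starMass E q e)) := fun e => by
    simp only [starMass, Finset.sum_div]
    exact tendsto_finsetSum _ fun p _ => h1 p
  have hpos : ∀ e ∈ E, 0 < starMass E q e := fun e he =>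
    Finset.sum_pos (fun p hp => (hqE p).2 (star_subset hp)) ⟨e, self_mem_star he⟩
  have h3 : ∀ e ∈ E, Tendsto (fun m : ℕ => share E (v m) e) atTop (𝓝 (share E q e)) :=
    fun e he => by
      refine ((h1 e).div (h2 e) (hpos e he).ne').congr' ?_
      filter_upwards [eventually_ge_atTop 1] with m hm
      have : (m : ℝ) ≠ 0 := by positivity
      simp only [Pi.div_apply]
      rw [div_div_div_cancel_right₀ this, share]
  have h4 : ∀ e ∈ E, Tendsto (fun m : ℕ => 1 / starMass E (v m) e) atTop (𝓝 0) :=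
    fun e he => by
      have := (tendsto_const_div_atTop_nhds_zero_nat (1 : ℝ)).div (h2 e) (hpos e he).ne'
      rw [zero_div] at this
      refine this.congr' ?_
      filter_upwards [eventually_ge_atTop 1] with m hm
      have : (m : ℝ) ≠ 0 := by positivity
      simp only [Pi.div_apply]
      rw [div_div_div_cancel_right₀ this]
  -- No pair outside `E` is reinforced in this start, since `q` vanishes there.
  have h5 : ∀ m, ∑ p ∈ Eᶜ, (v m p - V₀ p) = 0 := fun m => by
    refine Finset.sum_eq_zero fun p hp => ?_
    simp [hv, h0 p (Finset.mem_compl.1 hp)]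
  have h6 := (tendsto_finsetSum E fun e he =>
    ((h3 e he).sub_const (share E q e)).pow 2).const_mul (1 / δ ^ 2)
  have h7 := (tendsto_finsetSum E h4).const_mul K
  simp only [sub_self, ne_eq, OfNat.ofNat_ne_zero, not_false_eq_true, zero_pow,
    Finset.sum_const_zero, mul_zero] at h6 h7
  have h8 := h6.add h7
  rw [add_zero] at h8
  refine h8.congr fun m => ?_
  rw [forestLyapunov, h5, zero_add]

lemma exists_multiset_count_eq {ι : Type*} [Fintype ι] [DecidableEq ι] (k : ι → ℕ) :
    ∃ s : Multiset ι, ∀ i, s.count i = k i :=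
  ⟨Finsupp.toMultiset (Finsupp.equivFunOnFinite.symm k), fun i => by
    rw [Finsupp.count_toMultiset]; rfl⟩

variable {S : ℕ → Ω → S₁} {Y : ℕ → Ω → S₂} {Z : ℕ → Ω → S₁}
  {mΩ : MeasurableSpace Ω} {μ : Measure Ω} {ℱ : Filtration ℕ mΩ}

/-- The leaf end of the edge has mass `x e`, which cancels, and the other end has the mass of the
star. -/
lemma IsStarForest.efficiency_eq {x : S₁ × S₂ → ℝ} (hE : IsStarForest E) (hx : ∀ p, 0 ≤ x p)
    (hxE : ∀ p, 0 < x p ↔ p ∈ E) (he : e ∈ E) : efficiency x e = 1 / starMass E x e := by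
  have h0 : ∀ p ∉ E, x p = 0 := fun p hp =>
    le_antisymm (not_lt.1 fun h => hp ((hxE p).1 h)) (hx p)
  have hxe := (hxE e).2 he
  rw [efficiency, hE.mass_mul_mass_eq hx h0 he, div_mul_eq_div_div, div_self (ne_of_gt hxe)]

/-- With positive probability the occupation measure converges to a point near a given equilibrium
supported on a star forest. -/
theorem IsRothErevGame.measure_tendsto_pos [IsProbabilityMeasure μ]
    (h : IsRothErevGame μ ℱ V₀ S Y Z) (hV₀ : ∀ p, 0 < V₀ p) (hE : IsStarForest E)
    (hne : E.Nonempty) (hq : q ∈ simplex S₁ S₂) (hqE : ∀ p, 0 < q p ↔ p ∈ E) {y : ℝ}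
    (hy : ∀ e ∈ E, efficiency q e = y) {U : Set (S₁ × S₂ → ℝ)} (hU : U ∈ 𝓝[simplex S₁ S₂] q) :
    0 < μ {ω | (∃ x ∈ simplex S₁ S₂ ∩ U,
          Tendsto (fun n => occupation V₀ S Y Z n ω) atTop (𝓝 x) ∧ (∀ p, 0 < x p ↔ p ∈ E) ∧
          ∀ e ∈ E, efficiency x e = efficiency q e) ∧
        ∀ p, Tendsto (fun n => payoff V₀ S Y Z n ω p) atTop atTop ↔ p ∈ E} := by
  have : Nonempty S₁ := ⟨hne.choose.1⟩
  have hN := starCount_pos hne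
  have hq0 : ∀ p ∉ E, q p = 0 := fun p hp =>
    le_antisymm (not_lt.1 fun h => hp ((hqE p).1 h)) (hq.1 p)
  have hmass : ∀ e ∈ E, 0 < starMass E q e := fun e he =>
    Finset.sum_pos (fun p hp => (hqE p).2 (star_subset hp)) ⟨e, self_mem_star he⟩
  have hsh : ∀ e ∈ E, share E q e = q e * y := fun e he => by
    rw [← hy e he, hE.efficiency_eq hq.1 hqE he, share, mul_one_div]
  -- The shares are `q e * y`. They sum to the number of stars, and `q` has total mass `1`.
  have hyN : y = starCount E := by
    have h1 := hE.sum_share (v := q) fun p hp => (hqE p).2 hp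
    rw [Finset.sum_congr rfl hsh, ← Finset.sum_mul,
      Finset.sum_subset (Finset.subset_univ E) fun p _ hp => hq0 p hp, hq.2, one_mul] at h1
    exact h1
  have hapos : ∀ e ∈ E, 0 < share E q e := fun e he => div_pos ((hqE e).2 he) (hmass e he)
  -- the limit as a function of the limiting shares
  set X : (S₁ × S₂ → ℝ) → S₁ × S₂ → ℝ := fun l p => (if p ∈ E then l p else 0) / starCount E
    with hX
  have hXc : Continuous X := by
    refine continuous_pi fun p => ?_
    simp only [hX]
    split_ifs <;> fun_prop
  have hXq : X (share E q) = q := by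
    funext p
    simp only [hX]
    split_ifs with hp
    · rw [hsh p hp, hyN, mul_div_cancel_right₀ _ hN.ne']
    · rw [zero_div, hq0 p hp]
  obtain ⟨O, hO, hOU⟩ := mem_nhdsWithin_iff_exists_mem_nhds_inter.1 hU
  have hpre : X ⁻¹' O ∈ 𝓝 (share E q) :=
    hXc.continuousAt.preimage_mem_nhds (by rw [hXq]; exact hO)
  obtain ⟨r, hr, hrO⟩ := Metric.nhds_basis_closedBall.mem_iff.1 hpre
  obtain ⟨m, hm, hmin⟩ := Finset.exists_min_image E (share E q) hne
  -- The radius `r` keeps the limit in the neighbourhood; half of the smallest share keeps every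
  -- limiting share positive.
  set δ : ℝ := min r (share E q m / 2) with hδdef
  have hδ : 0 < δ := lt_min hr (half_pos (hapos m hm))
  have ha : ∀ e ∈ E, 2 * δ ≤ share E q e ∧ share E q e ≤ 1 := fun e he => by
    constructor
    · have := hmin e he
      have := min_le_right r (share E q m / 2)
      linarith
    · exact div_le_one_of_le₀ (le_starMass hq.1 he) (hmass e he).le
  obtain ⟨K, hK, hLyap, hae⟩ := h.ae_hasForestLimit hV₀ hE hδ ha
  obtain ⟨k, hk⟩ := ((tendsto_forestLyapunov_floor (V₀ := V₀) (δ := δ) (K := K) hq.1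
    hqE).eventually (gt_mem_nhds (by norm_num : (0 : ℝ) < 1 / 4))).exists
  obtain ⟨s, hs⟩ := exists_multiset_count_eq fun p => ⌊q p * (k : ℝ)⌋₊
  have hreach := h.exists_measure_payoff_eq_pos hV₀ s
  simp only [hs] at hreach
  have hpos := h.measure_forall_lt_pos hV₀ hLyap hreach hk
  refine hpos.trans_le (measure_mono_ae ?_)
  filter_upwards [hae] with ω hω hconf
  have hev : ∀ᶠ n in atTop,
      forestLyapunov E V₀ (share E q) δ K (payoff V₀ S Y Z n ω) < 1 / 2 :=
    eventually_atTop.2 ⟨_, hconf⟩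
  have hlim := hω hev
  have hw : ∀ n p, 0 < payoff V₀ S Y Z n ω p := fun n p => (hV₀ p).trans_le (le_payoff n ω p)
  have hoff : ∀ p ∉ E, ∀ᶠ n in atTop, payoff V₀ S Y Z n ω p ≤ V₀ p + 1 / 2 := fun p hp => by
    filter_upwards [hev] with n hn
    have h1 := (forestLyapunov_terms hV₀ (le_payoff n ω) hK hn).1
    have h2 := Finset.single_le_sum (f := fun p => payoff V₀ S Y Z n ω p - V₀ p)
      (fun r _ => sub_nonneg.2 (le_payoff n ω r)) (Finset.mem_compl.2 hp)
    linarith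
  choose! l hl using hlim.share
  obtain ⟨hsum, hstar, hocc⟩ := hlim.tendsto_div_sum hE hne hw (fun p hp => ⟨_, hoff p hp⟩) hl
  have hlδ : ∀ e ∈ E, |l e - share E q e| ≤ δ := fun e he => by
    refine le_of_tendsto ((hl e he).sub_const _).abs ?_
    filter_upwards [hev] with n hn
    exact (abs_share_sub_lt hV₀ (le_payoff n ω) hK hδ (by linarith) he).le
  have hlpos : ∀ e ∈ E, 0 < l e := fun e he => by
    have h1 := (abs_le.1 (hlδ e he)).1
    have h2 := (ha e he).1
    linarith
  have hxE : ∀ p, 0 < X l p ↔ p ∈ E := fun p => by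
    simp only [hX]
    split_ifs with hp
    · exact iff_of_true (div_pos (hlpos p hp) hN) hp
    · rw [zero_div]
      exact iff_of_false (lt_irrefl _) hp
  have hx0 : ∀ p, 0 ≤ X l p := fun p => by
    by_cases hp : p ∈ E
    · exact ((hxE p).2 hp).le
    · simp [hX, hp]
  have hxS : X l ∈ simplex S₁ S₂ := by
    refine ⟨hx0, ?_⟩
    simp only [hX]
    rw [← Finset.sum_div, Finset.sum_ite_mem, Finset.univ_inter, hsum, div_self hN.ne']
  have hxO : X l ∈ O := by
    -- `l` is arbitrary outside `E`, but `X` ignores those coordinates, so they may be replaced by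
    -- those of `share E q`.
    have h1 : X l = X fun p => if p ∈ E then l p else share E q p := by
      funext p
      simp only [hX]
      split_ifs <;> rfl
    rw [h1]
    refine hrO ?_
    rw [Metric.mem_closedBall, dist_pi_le_iff hr.le]
    intro p
    split_ifs with hp
    · exact (hlδ p hp).trans (min_le_left _ _)
    · rw [dist_self]; exact hr.le
  refine ⟨⟨X l, ⟨hxS, hOU ⟨hxO, hxS⟩⟩, tendsto_pi_nhds.2 hocc, hxE, fun e he => ?_⟩, fun p => ?_⟩
  · rw [hy e he, hE.efficiency_eq hx0 hxE he, hyN]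
    have h1 : starMass E (X l) e = 1 / starCount E := by
      rw [starMass, ← hstar e he, Finset.sum_div]
      refine Finset.sum_congr rfl fun p hp => ?_
      simp only [hX]
      rw [if_pos (star_subset hp)]
    rw [h1, one_div_one_div]
  · constructor
    · intro htop
      by_contra hp
      obtain ⟨n, h1, h2⟩ := ((hoff p hp).and (htop.eventually_gt_atTop (V₀ p + 1 / 2))).exists
      exact h1.not_gt h2
    · intro hp
      refine ((hl p hp).pos_mul_atTop (hlpos p hp) (hlim.starMass p hp)).congr fun n => ?_
      have : 0 < starMass E (payoff V₀ S Y Z n ω) p :=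
        Finset.sum_pos (fun r _ => hw n r) ⟨p, self_mem_star hp⟩
      rw [share, div_mul_cancel₀ _ this.ne']

end Convergence

/-! ### Linear stability -/

section LinearStability

variable {q : S₁ × S₂ → ℝ}

lemma sum_stateMass (u : S₁ × S₂ → ℝ) : ∑ i, stateMass u i = ∑ p, u p :=
  (Fintype.sum_prod_type u).symm

lemma sum_signalMass (u : S₁ × S₂ → ℝ) : ∑ j, signalMass u j = ∑ p, u p :=
  (Fintype.sum_prod_type_right u).symm

lemma differentiableAt_meanField (hs : ∀ i, stateMass q i ≠ 0) (hg : ∀ j, signalMass q j ≠ 0) :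
    DifferentiableAt ℝ (meanField : (S₁ × S₂ → ℝ) → S₁ × S₂ → ℝ) q := by
  have h1 : ∀ p : S₁ × S₂, DifferentiableAt ℝ
      (fun x : S₁ × S₂ → ℝ => stateMass x p.1 * signalMass x p.2) q := fun p => by
    unfold stateMass signalMass
    fun_prop
  have h2 : ∀ p : S₁ × S₂, stateMass q p.1 * signalMass q p.2 ≠ 0 := fun p =>
    mul_ne_zero (hs _) (hg _)
  have h3 : DifferentiableAt ℝ (potential : (S₁ × S₂ → ℝ) → ℝ) q := by
    unfold potential
    refine DifferentiableAt.fun_sum fun p _ => ?_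
    have hn : DifferentiableAt ℝ (fun x : S₁ × S₂ → ℝ => x p ^ 2) q := by fun_prop
    simp only [div_eq_mul_inv]
    exact hn.mul ((h1 p).fun_inv (h2 p))
  rw [differentiableAt_pi]
  intro p
  have hn : DifferentiableAt ℝ (fun x : S₁ × S₂ → ℝ => x p) q := by fun_prop
  have h4 : DifferentiableAt ℝ (fun x : S₁ × S₂ → ℝ => efficiency x p) q := by
    simp only [efficiency, div_eq_mul_inv]
    exact hn.mul ((h1 p).fun_inv (h2 p))
  exact hn.mul (h4.sub h3)

/-- The derivative of the mean field at an equilibrium, in the directions that do not leave its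
support. -/
lemma fderiv_meanField_apply (hs : ∀ i, stateMass q i ≠ 0) (hg : ∀ j, signalMass q j ≠ 0)
    (hy : ∀ p, q p ≠ 0 → efficiency q p = potential q) {u : S₁ × S₂ → ℝ}
    (hu : ∀ p, q p = 0 → u p = 0) (p : S₁ × S₂) :
    fderiv ℝ (meanField : (S₁ × S₂ → ℝ) → S₁ × S₂ → ℝ) q u p =
      potential q * (u p - q p * (stateMass u p.1 / stateMass q p.1 +
        signalMass u p.2 / signalMass q p.2)) := by
  have hline : HasDerivAt (fun t : ℝ => q + t • u) u 0 := by
    simpa using ((hasDerivAt_id (0 : ℝ)).smul_const u).const_add q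
  have hF : HasDerivAt (fun t : ℝ => meanField (q + t • u))
      (fderiv ℝ (meanField : (S₁ × S₂ → ℝ) → S₁ × S₂ → ℝ) q u) 0 := by
    have := (differentiableAt_meanField hs hg).hasFDerivAt
    exact this.comp_hasDerivAt_of_eq (0 : ℝ) hline (by simp)
  have hx : ∀ r, HasDerivAt (fun t : ℝ => (q + t • u) r) (u r) 0 := fun r =>
    (hasDerivAt_pi.1 hline) r
  have hS : ∀ i, HasDerivAt (fun t : ℝ => stateMass (q + t • u) i) (stateMass u i) 0 := fun i =>
    HasDerivAt.fun_sum fun j _ => hx (i, j)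
  have hG : ∀ j, HasDerivAt (fun t : ℝ => signalMass (q + t • u) j) (signalMass u j) 0 := fun j =>
    HasDerivAt.fun_sum fun i _ => hx (i, j)
  have hne : ∀ r : S₁ × S₂,
      stateMass (q + (0 : ℝ) • u) r.1 * signalMass (q + (0 : ℝ) • u) r.2 ≠ 0 :=
    fun r => by simpa using ⟨hs r.1, hg r.2⟩
  have heff : ∀ r : S₁ × S₂, HasDerivAt (fun t : ℝ => efficiency (q + t • u) r)
      ((u r * (stateMass q r.1 * signalMass q r.2) - q r * (stateMass u r.1 * signalMass q r.2 +
        stateMass q r.1 * signalMass u r.2)) / (stateMass q r.1 * signalMass q r.2) ^ 2) 0 := by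
    intro r
    refine ((hx r).fun_div ((hS r.1).fun_mul (hG r.2)) (hne r)).congr_deriv ?_
    simp
  have hqy : ∀ r, q r ≠ 0 → q r = potential q * (stateMass q r.1 * signalMass q r.2) :=
    fun r hr => by
      rw [← hy r hr, efficiency, div_mul_cancel₀ _ (mul_ne_zero (hs _) (hg _))]
  -- The equilibrium is a critical point of the potential along its support: the numerators
  -- contribute `2 ∑ u`, and the state and signal masses each take away `∑ u`.
  have hpot : HasDerivAt (fun t : ℝ => potential (q + t • u)) 0 0 := by
    have h1 : ∀ r : S₁ × S₂, HasDerivAt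
        (fun t : ℝ => (q + t • u) r ^ 2 / (stateMass (q + t • u) r.1 * signalMass (q + t • u) r.2))
        (potential q * (2 * u r - (stateMass u r.1 * (q r / stateMass q r.1) +
          signalMass u r.2 * (q r / signalMass q r.2)))) 0 := by
      intro r
      have h2 := ((hx r).pow 2).div ((hS r.1).mul (hG r.2)) (hne r)
      simp only [zero_smul, add_zero] at h2
      refine h2.congr_deriv ?_
      by_cases hr : q r = 0
      · simp [hr, hu r hr]
      · have hs' := hs r.1
        have hg' := hg r.2
        have hq' := hqy r hr
        simp only [Nat.cast_ofNat, Nat.add_one_sub_one, pow_one, Pi.pow_apply, Pi.mul_apply,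
          zero_smul, add_zero]
        have h3 : potential q = q r / (stateMass q r.1 * signalMass q r.2) :=
          (eq_div_iff (mul_ne_zero hs' hg')).2 hq'.symm
        rw [h3]
        field_simp
    have h2 := HasDerivAt.fun_sum (u := Finset.univ) fun r _ => h1 r
    refine h2.congr_deriv ?_
    rw [← Finset.mul_sum, Finset.sum_sub_distrib, Finset.sum_add_distrib, ← Finset.mul_sum]
    have h3 : ∑ r : S₁ × S₂, stateMass u r.1 * (q r / stateMass q r.1) = ∑ r, u r := by
      rw [Fintype.sum_prod_type, ← sum_stateMass u]
      refine Finset.sum_congr rfl fun i _ => ?_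
      simp only
      rw [← Finset.mul_sum, ← Finset.sum_div]
      change stateMass u i * (stateMass q i / stateMass q i) = _
      rw [div_self (hs i), mul_one]
    have h4 : ∑ r : S₁ × S₂, signalMass u r.2 * (q r / signalMass q r.2) = ∑ r, u r := by
      rw [Fintype.sum_prod_type_right, ← sum_signalMass u]
      refine Finset.sum_congr rfl fun j _ => ?_
      simp only
      rw [← Finset.mul_sum, ← Finset.sum_div]
      change signalMass u j * (signalMass q j / signalMass q j) = _
      rw [div_self (hg j), mul_one]
    rw [h3, h4]
    ring
  have hprod := (hx p).mul ((heff p).sub hpot)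
  have huniq := ((hasDerivAt_pi.1 hF) p).unique hprod
  rw [huniq]
  simp only [zero_smul, add_zero, sub_zero, Pi.sub_apply]
  by_cases hp : q p = 0
  · simp [hp, hu p hp]
  · have hs' := hs p.1
    have hg' := hg p.2
    have h3 : potential q = q p / (stateMass q p.1 * signalMass q p.2) :=
      (eq_div_iff (mul_ne_zero hs' hg')).2 (hqy p hp).symm
    rw [hy p hp, sub_self, mul_zero, zero_add, h3]
    field_simp

/-! ### Spectrum of the Jacobian and exclusion of paths -/

variable [DecidableEq S₁] [DecidableEq S₂]

lemma mem_spectrum_jacobian {u : S₁ × S₂ → ℝ} {c : ℝ} (hu : u ≠ 0)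
    (h : fderiv ℝ (meanField : (S₁ × S₂ → ℝ) → S₁ × S₂ → ℝ) q u = c • u) :
    (c : ℂ) ∈ spectrum ℂ ((jacobian q).map (algebraMap ℝ ℂ)) := by
  rw [← Matrix.spectrum_toLin']
  refine Module.End.HasEigenvalue.mem_spectrum
    (Module.End.hasEigenvalue_of_hasEigenvector (x := algebraMap ℝ ℂ ∘ u) ⟨?_, ?_⟩)
  · rw [Module.End.mem_eigenspace_iff]
    funext p
    rw [Matrix.toLin'_apply, ← RingHom.map_mulVec, jacobian, LinearMap.toMatrix'_mulVec]
    change algebraMap ℝ ℂ (fderiv ℝ (meanField : (S₁ × S₂ → ℝ) → S₁ × S₂ → ℝ) q u p) = _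
    rw [h]
    simp
  · intro h0
    refine hu (funext fun p => ?_)
    have := congrFun h0 p
    simpa using this

/-- The symmetrised negative Jacobian of an equilibrium, restricted to its support. -/
def symmJacobian (q : S₁ × S₂ → ℝ) : Matrix (S₁ × S₂) (S₁ × S₂) ℝ := fun p r =>
  potential q * (√(q p) * √(q r) * ((if p.1 = r.1 then 1 / stateMass q p.1 else 0) +
    if p.2 = r.2 then 1 / signalMass q p.2 else 0) - if p = r ∧ q p ≠ 0 then 1 else 0)

lemma symmJacobian_isHermitian (q : S₁ × S₂ → ℝ) : (symmJacobian q).IsHermitian := by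
  ext p r
  rw [Matrix.conjTranspose_apply, star_trivial, symmJacobian, symmJacobian]
  by_cases h1 : p.1 = r.1 <;> by_cases h2 : p.2 = r.2
  · rw [Prod.ext h1 h2]
  all_goals
    have h3 : p ≠ r := fun h => by simp_all
    simp [h1, h2, h3, h3.symm, eq_comm (a := r.1), eq_comm (a := r.2), mul_comm]

/-- By `fderiv_meanField_apply`, the right side is minus the Jacobian applied to `√q * w`.
Multiplication by `√q` thus carries eigenvectors of the symmetric matrix to eigenvectors of the
Jacobian, with the sign of the eigenvalue reversed. -/
lemma sqrt_mul_symmJacobian_mulVec (hq : ∀ p, 0 ≤ q p) (w : S₁ × S₂ → ℝ) (p : S₁ × S₂) :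
    √(q p) * (symmJacobian q).mulVec w p =
      -(potential q * (√(q p) * w p - q p *
        (stateMass (fun r => √(q r) * w r) p.1 / stateMass q p.1 +
          signalMass (fun r => √(q r) * w r) p.2 / signalMass q p.2))) := by
  have hterm : ∀ r, symmJacobian q p r * w r =
      potential q * √(q p) / stateMass q p.1 * (if r.1 = p.1 then √(q r) * w r else 0) +
      potential q * √(q p) / signalMass q p.2 * (if r.2 = p.2 then √(q r) * w r else 0) -
      potential q * if p = r then (if q p ≠ 0 then w p else 0) else 0 := by
    intro r
    simp only [symmJacobian, eq_comm (a := r.1), eq_comm (a := r.2), ite_and]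
    by_cases h3 : p = r
    · subst h3
      simp only [if_true]
      split_ifs <;> ring
    · simp only [if_neg h3]
      split_ifs <;> ring
  have hsum : (symmJacobian q).mulVec w p =
      potential q * √(q p) / stateMass q p.1 * stateMass (fun r => √(q r) * w r) p.1 +
      potential q * √(q p) / signalMass q p.2 * signalMass (fun r => √(q r) * w r) p.2 -
      potential q * if q p ≠ 0 then w p else 0 := by
    change ∑ r, symmJacobian q p r * w r = _
    rw [Finset.sum_congr rfl fun r _ => hterm r, Finset.sum_sub_distrib, Finset.sum_add_distrib,
      ← Finset.mul_sum, ← Finset.mul_sum, ← Finset.mul_sum, ← Finset.sum_filter,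
      ← Finset.sum_filter, ← stateMass_eq_sum_filter, ← signalMass_eq_sum_filter,
      Finset.sum_ite_eq, if_pos (Finset.mem_univ _)]
  have hsq := Real.mul_self_sqrt (hq p)
  have hite : √(q p) * (if q p ≠ 0 then w p else 0) = √(q p) * w p := by
    split_ifs with h
    · rfl
    · rw [not_not.1 h]; simp
  rw [hsum, mul_sub, mul_left_comm (√(q p)), hite]
  generalize stateMass (fun r => √(q r) * w r) p.1 = σ
  generalize signalMass (fun r => √(q r) * w r) p.2 = γ
  calc _ = potential q * (√(q p) * √(q p)) * (σ / stateMass q p.1 + γ / signalMass q p.2) -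
        potential q * (√(q p) * w p) := by ring
    _ = _ := by rw [hsq]; ring

/-- A linearly stable equilibrium has no path of three edges in its support. -/
lemma LinearlyStable.no_path (hq : ∀ p, 0 ≤ q p) (hs : ∀ i, stateMass q i ≠ 0)
    (hg : ∀ j, signalMass q j ≠ 0) (hy : ∀ p, q p ≠ 0 → efficiency q p = potential q)
    (hstable : LinearlyStable q) {a b c : S₁ × S₂} (ha : 0 < q a) (hb : 0 < q b) (hc : 0 < q c)
    (hab : a.1 = b.1) (hac : a.2 = c.2) (hab' : a ≠ b) (hac' : a ≠ c) : False := by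
  have hA := symmJacobian_isHermitian q
  have hpsd : (symmJacobian q).PosSemidef := by
    rw [hA.posSemidef_iff_eigenvalues_nonneg]
    by_contra hneg
    obtain ⟨k, hk⟩ : ∃ k, hA.eigenvalues k < 0 := by
      by_contra hcon
      push Not at hcon
      exact hneg hcon
    have hvec := hA.mulVec_eigenvectorBasis k
    have hw0 : (hA.eigenvectorBasis k).ofLp ≠ 0 := fun h0 =>
      hA.eigenvectorBasis.orthonormal.ne_zero k (by ext i; exact congrFun h0 i)
    generalize (hA.eigenvectorBasis k).ofLp = w at hvec hw0
    generalize hA.eigenvalues k = c at hvec hk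
    -- Rows outside the support vanish, so an eigenvector of a nonzero eigenvalue lives on the
    -- support, where multiplication by `√q` is injective.
    have hrow : ∀ p, q p = 0 → w p = 0 := fun p hp => by
      have h1 := congrFun hvec p
      have h2 : (symmJacobian q).mulVec w p = 0 :=
        Finset.sum_eq_zero fun r _ => by simp [symmJacobian, hp]
      rw [h2, Pi.smul_apply, smul_eq_mul] at h1
      exact (mul_eq_zero.1 h1.symm).resolve_left hk.ne
    have hu0 : (fun r => √(q r) * w r) ≠ 0 := by
      intro h0
      refine hw0 (funext fun p => ?_)
      by_cases hp : q p = 0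
      · exact hrow p hp
      · have := congrFun h0 p
        simp only [Pi.zero_apply] at this
        exact (mul_eq_zero.1 this).resolve_left
          (Real.sqrt_ne_zero'.2 (lt_of_le_of_ne (hq p) (Ne.symm hp)))
    have hder : fderiv ℝ (meanField : (S₁ × S₂ → ℝ) → S₁ × S₂ → ℝ) q (fun r => √(q r) * w r) =
        (-c) • fun r => √(q r) * w r := by
      funext p
      rw [fderiv_meanField_apply hs hg hy fun p hp => by simp [hp]]
      have h1 := sqrt_mul_symmJacobian_mulVec hq w p
      rw [hvec] at h1
      simp only [Pi.smul_apply, smul_eq_mul] at h1 ⊢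
      linarith
    have := hstable _ (mem_spectrum_jacobian hu0 hder)
    simp only [Complex.ofReal_re] at this
    linarith
  have hy0 : 0 < potential q := by
    rw [← hy a ha.ne']
    have h1 : 0 ≤ stateMass q a.1 := Finset.sum_nonneg fun _ _ => hq _
    have h2 : 0 ≤ signalMass q a.2 := Finset.sum_nonneg fun _ _ => hq _
    exact div_pos ha (mul_pos (lt_of_le_of_ne h1 (hs _).symm) (lt_of_le_of_ne h2 (hg _).symm))
  have hab2 : a.2 ≠ b.2 := fun h => hab' (Prod.ext hab h)
  have hga : q a < signalMass q a.2 := by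
    rw [signalMass_eq_sum_filter]
    exact Finset.single_lt_sum hac'.symm (by simp) (by simp [hac]) hc fun r _ _ => hq r
  have hgb : q b ≤ signalMass q b.2 := by
    rw [signalMass_eq_sum_filter]
    exact Finset.single_le_sum (f := q) (fun r _ => hq r) (by simp)
  -- Move mass between the two edges `a` and `b` at a common state: the state terms cancel, and what
  -- remains is negative because `c` makes the signal mass at `a` exceed `q a`.
  have hform := hpsd.dotProduct_mulVec_nonneg
    (Pi.single a (1 / √(q a)) - Pi.single b (1 / √(q b)))
  have hsa := Real.sqrt_ne_zero'.2 ha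
  have hsb := Real.sqrt_ne_zero'.2 hb
  have hsqa := Real.mul_self_sqrt ha.le
  have hsqb := Real.mul_self_sqrt hb.le
  rw [star_trivial, sub_dotProduct, single_dotProduct, single_dotProduct, Matrix.mulVec_sub,
    Matrix.mulVec_single, Matrix.mulVec_single] at hform
  simp only [Pi.sub_apply, Pi.smul_apply, Matrix.col_apply, MulOpposite.smul_eq_mul_unop,
    MulOpposite.unop_op, symmJacobian, hab, hab2, hab', hab'.symm, hab2.symm, ha.ne', hb.ne',
    ne_eq, not_false_eq_true, and_self, and_true, if_true, if_false,
    sub_zero, add_zero] at hform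
  have hs0 := hs b.1
  have hg1 := hg a.2
  have hg2 := hg b.2
  have hval : potential q * ((1 / signalMass q a.2 - 1 / q a) +
      (1 / signalMass q b.2 - 1 / q b)) < 0 := by
    have h1 : 1 / signalMass q a.2 < 1 / q a := one_div_lt_one_div_of_lt ha hga
    have h2 : 1 / signalMass q b.2 ≤ 1 / q b := one_div_le_one_div_of_le hb hgb
    exact mul_neg_of_pos_of_neg hy0 (by linarith)
  refine hval.not_ge (hform.trans_eq ?_)
  generalize √(q a) = α at *
  generalize √(q b) = β at *
  rw [← hsqa, ← hsqb]
  field_simp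
  ring

end LinearStability

/-! ### Graphs and star forests -/

section Graphs

lemma supportGraph_adj (x : S₁ × S₂ → ℝ) (i : S₁) (j : S₂) :
    (supportGraph x).Adj (Sum.inl i) (Sum.inr j) ↔ 0 < x (i, j) := by
  simp [supportGraph]

lemma supportGraph_eq {G : SimpleGraph (S₁ ⊕ S₂)} (hG : G ≤ completeBipartiteGraph S₁ S₂)
    {x : S₁ × S₂ → ℝ} (hx : ∀ i j, 0 < x (i, j) ↔ G.Adj (Sum.inl i) (Sum.inr j)) :
    supportGraph x = G := by
  ext u v
  rcases u with i | j <;> rcases v with i' | j'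
  · have h1 : ¬ G.Adj (Sum.inl i) (Sum.inl i') := fun h => by simpa using hG h
    simp [supportGraph, h1]
  · rw [supportGraph_adj, hx]
  · rw [SimpleGraph.adj_comm, supportGraph_adj, hx, SimpleGraph.adj_comm]
  · have h1 : ¬ G.Adj (Sum.inr j) (Sum.inr j') := fun h => by simpa using hG h
    simp [supportGraph, h1]

lemma supportGraph_le (x : S₁ × S₂ → ℝ) : supportGraph x ≤ completeBipartiteGraph S₁ S₂ := by
  intro u v h
  rcases u with i | j <;> rcases v with i' | j' <;> simp [supportGraph] at h ⊢

/-- In a component with a single state an edge is determined by its signal, and symmetrically with a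
single signal. -/
lemma PropertyP.isStarForest {G : SimpleGraph (S₁ ⊕ S₂)} (hG : G ≤ completeBipartiteGraph S₁ S₂)
    (hP : PropertyP G) {E : Finset (S₁ × S₂)}
    (hE : ∀ p, p ∈ E ↔ G.Adj (Sum.inl p.1) (Sum.inr p.2)) : IsStarForest E where
  leaf e he := by
    have hmem : ∀ e' ∈ E, e'.1 = e.1 ∨ e'.2 = e.2 →
        G.connectedComponentMk (Sum.inl e'.1) = G.connectedComponentMk (Sum.inl e.1) ∧
        G.connectedComponentMk (Sum.inr e'.2) = G.connectedComponentMk (Sum.inl e.1) := by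
      intro e' he' h
      have h1 := SimpleGraph.ConnectedComponent.connectedComponentMk_eq_of_adj ((hE e').1 he')
      have h2 := SimpleGraph.ConnectedComponent.connectedComponentMk_eq_of_adj ((hE e).1 he)
      rcases h with h | h
      · rw [← h1, h]; exact ⟨rfl, rfl⟩
      · rw [h1, h, h2]; exact ⟨rfl, rfl⟩
    have h0 := hmem e he (Or.inl rfl)
    rcases hP.component (G.connectedComponentMk (Sum.inl e.1)) with h | h
    · refine Or.inr fun e' he' h2 => Prod.ext (h.unique ?_ ?_) h2
      · exact (hmem e' he' (Or.inr h2)).1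
      · exact h0.1
    · refine Or.inl fun e' he' h1 => Prod.ext h1 (h.unique ?_ ?_)
      · exact (hmem e' he' (Or.inl h1)).2
      · exact h0.2
  state i := by
    obtain ⟨w, hw⟩ := hP.edge (Sum.inl i)
    rcases w with i' | j
    · simpa using hG hw
    · exact ⟨(i, j), (hE _).2 hw, rfl⟩
  signal j := by
    obtain ⟨w, hw⟩ := hP.edge (Sum.inr j)
    rcases w with i | j'
    · exact ⟨(i, j), (hE _).2 hw.symm, rfl⟩
    · simpa using hG hw

variable [DecidableEq S₁] [DecidableEq S₂]

/-- The support of a linearly stable equilibrium is a star forest. -/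
lemma isStarForest_of_mem_stableEquilibria {q : S₁ × S₂ → ℝ} (hq : q ∈ stableEquilibria S₁ S₂)
    {E : Finset (S₁ × S₂)} (hE : ∀ p, 0 < q p ↔ p ∈ E) :
    IsStarForest E ∧ ∀ e ∈ E, efficiency q e = potential q := by
  obtain ⟨⟨hΔ, hF⟩, hbd, hst⟩ := hq
  have hs : ∀ i, stateMass q i ≠ 0 := fun i h => hbd ⟨hΔ, Or.inl ⟨i, h⟩⟩
  have hg : ∀ j, signalMass q j ≠ 0 := fun j h => hbd ⟨hΔ, Or.inr ⟨j, h⟩⟩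
  have hy : ∀ p, q p ≠ 0 → efficiency q p = potential q := fun p hp => by
    have := congrFun hF p
    exact sub_eq_zero.1 ((mul_eq_zero.1 this).resolve_left hp)
  refine ⟨⟨fun e he => ?_, fun i => ?_, fun j => ?_⟩, fun e he => hy e ((hE e).2 he).ne'⟩
  -- If `e` has no leaf end, it is the middle edge of a path of three edges.
  · by_contra hcon
    push Not at hcon
    obtain ⟨⟨b, hb, hb1, hbe⟩, c, hc, hc2, hce⟩ := hcon
    exact hst.no_path hΔ.1 hs hg hy ((hE e).2 he) ((hE b).2 hb) ((hE c).2 hc) hb1.symm hc2.symm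
      hbe.symm hce.symm
  · obtain ⟨j, -, hj⟩ := Finset.exists_ne_zero_of_sum_ne_zero (hs i)
    exact ⟨(i, j), (hE _).1 (lt_of_le_of_ne (hΔ.1 _) hj.symm), rfl⟩
  · obtain ⟨i, -, hi⟩ := Finset.exists_ne_zero_of_sum_ne_zero (hg j)
    exact ⟨(i, j), (hE _).1 (lt_of_le_of_ne (hΔ.1 _) hi.symm), rfl⟩

/-- Every star forest is the support of an equilibrium. -/
lemma IsStarForest.exists_equilibrium {E : Finset (S₁ × S₂)} (hE : IsStarForest E)
    (hne : E.Nonempty) :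
    ∃ q ∈ simplex S₁ S₂, (∀ p, 0 < q p ↔ p ∈ E) ∧
      ∀ e ∈ E, efficiency q e = starCount E := by
  have hN := starCount_pos hne
  -- Every star gets the same mass, the inverse of the number of stars, spread evenly over its
  -- edges.
  set q : S₁ × S₂ → ℝ := fun p => (if p ∈ E then 1 / ((star E p).card : ℝ) else 0) / starCount E
    with hq
  have hcard : ∀ e ∈ E, 0 < ((star E e).card : ℝ) := fun e he =>
    Nat.cast_pos.2 (Finset.card_pos.2 ⟨e, self_mem_star he⟩)
  have hqE : ∀ p, 0 < q p ↔ p ∈ E := fun p => by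
    simp only [hq]
    split_ifs with hp
    · exact iff_of_true (div_pos (one_div_pos.2 (hcard p hp)) hN) hp
    · rw [zero_div]
      exact iff_of_false (lt_irrefl _) hp
  have hq0 : ∀ p, 0 ≤ q p := fun p => by
    by_cases hp : p ∈ E
    · exact ((hqE p).2 hp).le
    · simp [hq, hp]
  refine ⟨q, ⟨hq0, ?_⟩, hqE, fun e he => ?_⟩
  · simp only [hq]
    rw [← Finset.sum_div, Finset.sum_ite_mem, Finset.univ_inter]
    exact div_self hN.ne'
  · have h1 : starMass E q e = 1 / starCount E := by
      have h2 : ∀ p ∈ star E e, q p = 1 / ((star E e).card : ℝ) / starCount E := fun p hp => by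
        simp only [hq]
        rw [if_pos (star_subset hp), hE.star_eq he hp]
      rw [starMass, Finset.sum_congr rfl h2, Finset.sum_const, nsmul_eq_mul, mul_div_assoc',
        mul_one_div_cancel (hcard e he).ne']
    rw [hE.efficiency_eq hq0 hqE he, h1, one_div_one_div]

end Graphs

end SignalingGame

end
theorem mainTheorem1 {S₁ S₂ : Type*} [Fintype S₁] [Fintype S₂] [DecidableEq S₁] [DecidableEq S₂]
    {Ω : Type*} {mΩ : MeasurableSpace Ω} (μ : Measure Ω) [IsProbabilityMeasure μ]
    (ℱ : Filtration ℕ mΩ) (V₀ : S₁ × S₂ → ℝ) (hV₀ : ∀ p, 0 < V₀ p)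
    (S : ℕ → Ω → S₁) (Y : ℕ → Ω → S₂) (Z : ℕ → Ω → S₁)
    (hgame : IsRothErevGame μ ℱ V₀ S Y Z) :
    (∀ G : SimpleGraph (S₁ ⊕ S₂), G ≤ completeBipartiteGraph S₁ S₂ → PropertyP G →
      0 < μ {ω | (∃ x ∈ simplex S₁ S₂,
            Tendsto (fun n => occupation V₀ S Y Z n ω) atTop (𝓝 x) ∧ supportGraph x = G) ∧
          ∀ i j, Tendsto (fun n => payoff V₀ S Y Z n ω (i, j)) atTop atTop ↔
            G.Adj (Sum.inl i) (Sum.inr j)}) ∧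
    (∀ q ∈ stableEquilibria S₁ S₂, ∀ U ∈ 𝓝[simplex S₁ S₂] q,
      0 < μ {ω | (∃ x ∈ simplex S₁ S₂ ∩ U,
            Tendsto (fun n => occupation V₀ S Y Z n ω) atTop (𝓝 x) ∧
            supportGraph x = supportGraph q ∧
            ∀ i j, (supportGraph q).Adj (Sum.inl i) (Sum.inr j) →
              efficiency x (i, j) = efficiency q (i, j)) ∧
          ∀ i j, Tendsto (fun n => payoff V₀ S Y Z n ω (i, j)) atTop atTop ↔
            (supportGraph q).Adj (Sum.inl i) (Sum.inr j)}) := by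
  classical
  obtain ⟨ω₀⟩ := nonempty_of_isProbabilityMeasure μ
  constructor
  · intro G hG hP
    set E : Finset (S₁ × S₂) := {p | G.Adj (Sum.inl p.1) (Sum.inr p.2)} with hEdef
    have hEmem : ∀ p, p ∈ E ↔ G.Adj (Sum.inl p.1) (Sum.inr p.2) := fun p => by simp [hEdef]
    have hE := hP.isStarForest hG hEmem
    have hne : E.Nonempty := by
      obtain ⟨e, he, -⟩ := hE.state (S 0 ω₀)
      exact ⟨e, he⟩
    obtain ⟨q, hq, hqE, hy⟩ := hE.exists_equilibrium hne
    -- Only the support of the limit matters here, so any equilibrium on `E` and the trivial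
    -- neighbourhood suffice.
    refine (hgame.measure_tendsto_pos hV₀ hE hne hq hqE hy univ_mem).trans_le (measure_mono ?_)
    rintro ω ⟨⟨x, hx, hlim, hxE, -⟩, htop⟩
    refine ⟨⟨x, hx.1, hlim, supportGraph_eq hG fun i j => ?_⟩, fun i j => ?_⟩
    · rw [hxE, hEmem]
    · rw [htop, hEmem]
  · intro q hq U hU
    set E : Finset (S₁ × S₂) := {p | 0 < q p} with hEdef
    have hEmem : ∀ p, 0 < q p ↔ p ∈ E := fun p => by simp [hEdef]
    obtain ⟨hE, hy⟩ := isStarForest_of_mem_stableEquilibria hq hEmem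
    have hne : E.Nonempty := by
      obtain ⟨e, he, -⟩ := hE.state (S 0 ω₀)
      exact ⟨e, he⟩
    refine (hgame.measure_tendsto_pos hV₀ hE hne hq.1.1 hEmem hy hU).trans_le (measure_mono ?_)
    rintro ω ⟨⟨x, hx, hlim, hxE, heff⟩, htop⟩
    refine ⟨⟨x, hx, hlim, supportGraph_eq (supportGraph_le q) fun i j => ?_,
      fun i j hij => ?_⟩, fun i j => ?_⟩
    · rw [hxE, supportGraph_adj, hEmem]
    · rw [supportGraph_adj, hEmem] at hij
      exact heff _ hij
    · rw [htop, supportGraph_adj, hEmem]
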